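/- Let $\mathbf U$ be the open unit disk. For a real harmonic function $u$ on $\mathbf U$ put $\|u\|_{h^p}=\left(\sup_{0<r<1}\int_0^{2\pi}|u(re^{it})|^p\,dt\right)^{1/p}$ if $1\le p<\infty$ and $\|u\|_{h^\infty}=\sup_{\mathbf U}|u|$, and let $h^p$ be the class of those $u$ with $\|u\|_{h^p}<\infty$. Let $E_{m,p}(u)=\inf_P\|u-\Re P\|_{h^p}$, where $P$ runs over the complex polynomials of degree at most $m$. Let $1\le p\le\infty$, let $q$ be the conjugate exponent, $\frac1p+\frac1q=1$ (with $1/\infty=0$), and let $n\ge1$ be an integer. Put $$C_{p,n}=\frac{n!}{\pi}\,2^{\,n+1-1/q}\max_{0\le\beta\le\pi/2}F_q(\beta)^{1/q},\qquad F_q(\beta)=\int_0^\pi\left|\sin^{\,n+1-2/q}v\,\cos\left[(n+1)v+\beta-\tfrac{\pi}{2}(n-1)\right]\right|^q dv;$$ for $q=\infty$ the symbol $F_q(\beta)^{1/q}$ stands for $\max_{0\le v\le\pi}\left|\sin^{n+1}v\,\cos\left[(n+1)v+\beta-\tfrac{\pi}{2}(n-1)\right]\right|$. The maximum over $\beta$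 is attained, and the following holds. (a) If $f$ is analytic on $\mathbf U$ with $\Re f\in h^p$ and $\mathcal P$ is a polynomial of degree at most $n-1$, then $\Re(f-\mathcal P)\in h^p$ and, for every $z\in\mathbf U$, $$|f^{(n)}(z)|\le C_{p,n}\,(1-|z|^2)^{-1/p-n}\,\|\Re(f-\mathcal P)\|_{h^p}.$$ (b) The constant is sharp: for every polynomial $\mathcal P$ of degree at most $n-1$, if a real number $K$ is such that $|f^{(n)}(z)|\le K(1-|z|^2)^{-1/p-n}\|\Re(f-\mathcal P)\|_{h^p}$ for all $z\in\mathbf U$ and all analytic $f$ on $\mathbf U$ with $\Re f\in h^p$, then $K\ge C_{p,n}$. (c) In particular, for every such $f$ and every $z\in\mathbf U$, $|f^{(n)}(z)|\le C_{p,n}(1-|z|^2)^{-1/p-n}E_{n-1,p}(\Re f)$. -/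

import Mathlib

open scoped ENNReal

noncomputable section

namespace HardyReal

/-- The norm of the harmonic Hardy class `h^p` of the unit disk, as an extended nonnegative number:
`(sup_{0<r<1} ∫_0^{2π} |u(r e^{it})|^p dt)^{1/p}` for finite `p` (the measure `dt` on the circle is
not normalized), and the supremum of `|u|` over the disk for `p = ∞`. -/
def hpENorm (p : ℝ≥0∞) (u : ℂ → ℝ) : ℝ≥0∞ :=
  if p = ∞ then ⨆ z ∈ Metric.ball (0 : ℂ) 1, ‖u z‖ₑ
  else (⨆ r ∈ Set.Ioo (0 : ℝ) 1,
    ∫⁻ t in Set.Ioc 0 (2 * Real.pi), ‖u (circleMap 0 r t)‖ₑ ^ p.toReal) ^ (1 / p.toReal)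

/-- The real number `‖u‖_{h^p}`, meaningful for `u ∈ h^p`. -/
def hpNorm (p : ℝ≥0∞) (u : ℂ → ℝ) : ℝ := (hpENorm p u).toReal

/-- Membership in the harmonic Hardy class `h^p` of the unit disk. -/
def MemHp (p : ℝ≥0∞) (u : ℂ → ℝ) : Prop :=
  InnerProductSpace.HarmonicOnNhd u (Metric.ball (0 : ℂ) 1) ∧ hpENorm p u < ∞

/-- `E_{m,p}(u)`: the infimum of `‖u - Re P‖_{h^p}` over the complex polynomials `P` of degree
at most `m`. -/
def bestApprox (m : ℕ) (p : ℝ≥0∞) (u : ℂ → ℝ) : ℝ :=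
  (⨅ P : {P : Polynomial ℂ // P.natDegree ≤ m},
    hpENorm p (fun z => u z - ((P : Polynomial ℂ).eval z).re)).toReal

/-- `φ_β(v) = sin^{n+1-2/q} v · cos[(n+1) v + β - (n-1) π/2]`, where `1/∞ = 0`. -/
def phi (n : ℕ) (q : ℝ≥0∞) (β v : ℝ) : ℝ :=
  Real.sin v ^ ((n : ℝ) + 1 - 2 * (q⁻¹).toReal) *
    Real.cos (((n : ℝ) + 1) * v + β - Real.pi / 2 * ((n : ℝ) - 1))

/-- `F_q(β) = ∫_0^π |φ_β(v)|^q dv` for finite `q`. -/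
def F (n : ℕ) (q : ℝ≥0∞) (β : ℝ) : ℝ :=
  ∫ v in (0 : ℝ)..Real.pi, |phi n q β v| ^ q.toReal

/-- `F_q(β)^{1/q}`, that is, the `L^q` norm of `φ_β` on `[0, π]`; for `q = ∞` it is
`max_{0 ≤ v ≤ π} |φ_β(v)|`. -/
def FRoot (n : ℕ) (q : ℝ≥0∞) (β : ℝ) : ℝ :=
  if q = ∞ then sSup ((fun v => |phi n q β v|) '' Set.Icc 0 Real.pi)
  else F n q β ^ (1 / q.toReal)

/-- `(n!/π) · 2^{n+1-1/q} · max_{0 ≤ β ≤ π/2} F_q(β)^{1/q}`, as a function of the conjugate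
exponent `q` of `p`. -/
def sharpConst (n : ℕ) (q : ℝ≥0∞) : ℝ :=
  (n.factorial : ℝ) / Real.pi * (2 : ℝ) ^ ((n : ℝ) + 1 - (q⁻¹).toReal) *
    sSup (FRoot n q '' Set.Icc 0 (Real.pi / 2))

end HardyReal

end

/-! Write `n = b + 1`. Differentiating the Herglotz formula gives `f⁽ⁿ⁾(z) = (n!/π) ∫ ζ/(ζ -
z)^(n+1) Re f(ζ) dt` over the unit circle (after rescaling from a smaller circle). By Hölder, the
sharp constant at `z` is governed by the `L^q` norms of the real kernels `Re (a ζ/(ζ - z)^(n+1))`,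
`|a| = 1`.

The Möbius substitution `ζ = (w + z)/(1 + z̄ w)` turns the kernel into a positive factor times the
conjugate of `w (w + z)^b` (`kernel_moebius`). The factor `(1 - |z|²)^(-1/p - n)` then comes out of
the norm, and for finite `q = Q` there remains the `Q`-th root of `circlePowerIntegral`
(`integral_abs_re_kernel_rpow`).

The main point is that this remaining integral satisfies a maximum principle in `z`. With `s = w +
z` its integrand is the `Q`-th power of `|s|^κ |Re (C s^b)|`, `κ = 2(Q - 1)/Q`. That function has
the local sub-mean value property away from `0`, because near `s = 1` the function `|s|^κ Re s^b`
dominates the harmonic function `Re s^(b+κ)`, with equality at `1`. Hence the worst `z` lies on the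
unit circle (`circlePowerIntegral_le_of_sphere`); there a rotation and a half-angle substitution
produce `F_q(β)`. For `q = ∞` a direct bound on the kernel suffices.

Sharpness comes from Hölder's equality case: the Herglotz integral of `|k|^(q-1) sgn k`
(`exists_extremal`), tested at `z = r → 1`. For `p = 1` the boundary function is replaced by a point
mass, giving `(1 + z)/(1 - z)`. Polynomials of degree less than `n` do not affect the derivative, so
they can be subtracted or added freely. -/

namespace HardyReal

open Complex Metric Set MeasureTheory Filter Topology

/-! ### Sub-mean value inequalities and a maximum principle. -/

section Submean

/-- Near `1`, the function `‖s‖ ^ κ * Re (s ^ b)` dominates the harmonic function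
`Re (s ^ (b + κ))`. -/
theorem exists_re_cpow_le_norm_rpow_mul_re_pow (b : ℕ) {κ : ℝ} (hκ : 0 ≤ κ) :
    ∃ ε > 0, ε < 1 ∧ ∀ s : ℂ, ‖s - 1‖ ≤ ε →
      (s ^ (((b : ℝ) + κ : ℝ) : ℂ)).re ≤ ‖s‖ ^ κ * (s ^ b).re := by
  have hc : ContinuousAt (fun s : ℂ => ((b : ℝ) + κ) * |arg s|) 1 :=
    continuousAt_const.mul (continuousAt_arg (by simp)).abs
  have h1 : ∀ᶠ s : ℂ in 𝓝 1, ((b : ℝ) + κ) * |arg s| < Real.pi := by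
    apply hc.eventually_lt continuousAt_const
    simp [Real.pi_pos]
  obtain ⟨ε, hε, h⟩ := Metric.eventually_nhds_iff_ball.1 h1
  refine ⟨min (ε / 2) (1 / 2), by positivity, by
    have := min_le_right (ε / 2) (1 / 2); linarith, fun s hs => ?_⟩
  have hs1 : ‖s - 1‖ ≤ ε / 2 := hs.trans (min_le_left _ _)
  have hs2 : ‖s - 1‖ ≤ 1 / 2 := hs.trans (min_le_right _ _)
  have hs0 : s ≠ 0 := by
    rintro rfl
    norm_num at hs2
  have harg := h s (by rw [mem_ball, dist_eq_norm]; linarith)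
  have hpos : 0 < ‖s‖ := norm_pos_iff.2 hs0
  have e1 : (s ^ (((b : ℝ) + κ : ℝ) : ℂ)).re
      = ‖s‖ ^ ((b : ℝ) + κ) * Real.cos (((b : ℝ) + κ) * |arg s|) := by
    rw [Complex.cpow_ofReal, mul_comm (arg s)]
    rw [← Real.cos_abs (_ * arg s), abs_mul, abs_of_nonneg (by positivity : 0 ≤ (b : ℝ) + κ)]
    rw [Complex.re_ofReal_mul]
    congr 1
    simp [-Complex.ofReal_mul, Complex.cos_ofReal_re]
  have e2 : (s ^ b).re = ‖s‖ ^ (b : ℝ) * Real.cos ((b : ℝ) * |arg s|) := by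
    rw [← Complex.cpow_natCast, ← Complex.ofReal_natCast b, Complex.cpow_ofReal, mul_comm (arg s)]
    rw [← Real.cos_abs (_ * arg s), abs_mul, abs_of_nonneg (by positivity : 0 ≤ (b : ℝ))]
    rw [Complex.re_ofReal_mul]
    congr 1
    simp [-Complex.ofReal_mul, Complex.cos_ofReal_re]
  rw [e1, e2, Real.rpow_add hpos]
  -- Cosine decreases on `[0, π]`; `ε` was chosen so that the larger angle `(b + κ)|arg s|` stays
  -- below `π`.
  have hcos := Real.cos_le_cos_of_nonneg_of_le_pi (x := (b : ℝ) * |arg s|)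
    (y := ((b : ℝ) + κ) * |arg s|) (by positivity) harg.le
    (by gcongr; linarith)
  have hp : 0 ≤ ‖s‖ ^ (b : ℝ) * ‖s‖ ^ κ := by positivity
  nlinarith [mul_le_mul_of_nonneg_left hcos hp]

theorem continuous_norm_rpow_mul_pow (b : ℕ) {κ : ℝ} (hκ : 0 ≤ κ) :
    Continuous fun s : ℂ => ((‖s‖ ^ κ : ℝ) : ℂ) * s ^ b :=
  (continuous_ofReal.comp (continuous_norm.rpow_const fun _ => Or.inr hκ)).mul (continuous_pow b)

theorem circleIntegrable_of_continuous {E : Type*} [NormedAddCommGroup E] {f : ℂ → E}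
    (hf : Continuous f) (c : ℂ) (R : ℝ) : CircleIntegrable f c R :=
  hf.continuousOn.circleIntegrable'

/-- Over small circles around `1`, the mean of `‖s‖ ^ κ * s ^ b` is a real number `≥ 1`. -/
theorem exists_circleAverage_norm_rpow_mul_pow (b : ℕ) {κ : ℝ} (hκ : 0 ≤ κ) :
    ∃ ε > 0, ε < 1 ∧ ∀ r, 0 < r → r ≤ ε → ∃ m : ℝ, 1 ≤ m ∧
      Real.circleAverage (fun s : ℂ => ((‖s‖ ^ κ : ℝ) : ℂ) * s ^ b) 1 r = m := by
  obtain ⟨ε, hε, hε1, h⟩ := exists_re_cpow_le_norm_rpow_mul_re_pow b hκ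
  refine ⟨ε, hε, hε1, fun r hr0 hr => ?_⟩
  set g : ℂ → ℂ := fun s => ((‖s‖ ^ κ : ℝ) : ℂ) * s ^ b with hg
  have hgc : Continuous g := continuous_norm_rpow_mul_pow b hκ
  -- The mean is real because the circle about `1` and the integrand are both symmetric under
  -- conjugation.
  have hconj : (starRingEnd ℂ) (Real.circleAverage g 1 r) = Real.circleAverage g 1 r := by
    have h1 : ∀ θ : ℝ, g (circleMap 1 r (2 * Real.pi - θ)) =
        (starRingEnd ℂ) (g (circleMap 1 r θ)) := by
      intro θ
      have : circleMap 1 r (2 * Real.pi - θ) = (starRingEnd ℂ) (circleMap 1 r θ) := by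
        simp only [circleMap, map_add, map_one, map_mul, Complex.conj_ofReal, ← Complex.exp_conj,
          Complex.conj_I]
        congr 2
        push_cast
        rw [sub_mul, Complex.exp_sub, Complex.exp_two_pi_mul_I, mul_neg, Complex.exp_neg,
          one_div]
      rw [this]
      simp [hg]
    rw [Real.circleAverage_def]
    have h2 := intervalIntegral.integral_comp_sub_left (a := 0) (b := 2 * Real.pi)
      (fun θ => g (circleMap 1 r θ)) (2 * Real.pi)
    simp only [h1, sub_self, sub_zero] at h2
    rw [Complex.real_smul, map_mul, Complex.conj_ofReal]
    congr 1
    conv_rhs => rw [← h2]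
    rw [intervalIntegral.integral_of_le (by positivity), ← integral_conj,
      intervalIntegral.integral_of_le (by positivity)]
  have hre : 1 ≤ (Real.circleAverage g 1 r).re := by
    have e : (Real.circleAverage g 1 r).re = Real.circleAverage (fun s => (g s).re) 1 r :=
      (Complex.reCLM.circleAverage_comp_comm (circleIntegrable_of_continuous hgc 1 r)).symm
    have hd : DiffContOnCl ℂ (fun s : ℂ => s ^ (((b : ℝ) + κ : ℝ) : ℂ)) (ball 1 |r|) := by
      apply DifferentiableOn.diffContOnCl
      intro s hs
      have hs' := closure_ball_subset_closedBall hs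
      rw [mem_closedBall, dist_eq_norm, abs_of_pos hr0] at hs'
      apply DifferentiableAt.differentiableWithinAt
      refine (differentiableAt_id).cpow_const ?_
      rw [id, Complex.mem_slitPlane_iff]
      left
      have := Complex.abs_re_le_norm (s - 1)
      rw [Complex.sub_re, Complex.one_re] at this
      have := neg_le_of_abs_le this
      linarith
    have e3 := hd.circleAverage
    have hint : CircleIntegrable (fun s : ℂ => s ^ (((b : ℝ) + κ : ℝ) : ℂ)) 1 r := by
      apply ContinuousOn.circleIntegrable'
      exact hd.continuousOn.mono (by
        rw [closure_ball _ (abs_pos.2 hr0.ne').ne']; exact sphere_subset_closedBall)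
    -- Since `r < 1`, the disk stays in the right half-plane, where `s^(b+κ)` is holomorphic; its
    -- mean is its value `1` at the centre.
    have e4 : Real.circleAverage (fun s : ℂ => (s ^ (((b : ℝ) + κ : ℝ) : ℂ)).re) 1 r = 1 := by
      have := Complex.reCLM.circleAverage_comp_comm hint
      rw [e3] at this
      simpa [Function.comp_def] using this
    rw [e, ← e4]
    apply Real.circleAverage_mono
    · exact ⟨hint.1.re, hint.2.re⟩
    · exact circleIntegrable_of_continuous (Complex.continuous_re.comp hgc) 1 r
    · intro s hs
      rw [mem_sphere, dist_eq_norm, abs_of_pos hr0] at hs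
      simp only [hg, Complex.re_ofReal_mul]
      exact h s (hs ▸ hr)
  refine ⟨(Real.circleAverage g 1 r).re, hre, ?_⟩
  exact (Complex.conj_eq_iff_re.1 hconj).symm

theorem continuous_norm_rpow_mul_abs_re (b : ℕ) {κ : ℝ} (hκ : 0 ≤ κ) (C : ℂ) :
    Continuous fun s : ℂ => ‖s‖ ^ κ * |(C * s ^ b).re| :=
  (continuous_norm.rpow_const fun _ => Or.inr hκ).mul
    (Complex.continuous_re.comp (continuous_const.mul (continuous_pow b))).abs

/-- Local sub-mean value property of `‖s‖ ^ κ * |Re (C * s ^ b)|`, with a radius which is uniform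
in `C` and proportional to the norm of the centre. -/
theorem exists_le_circleAverage_norm_rpow_mul_abs_re (b : ℕ) {κ : ℝ} (hκ : 0 ≤ κ) :
    ∃ ε > 0, ε < 1 ∧ ∀ (C s₀ : ℂ) (r : ℝ), 0 < r → r ≤ ε * ‖s₀‖ →
      ‖s₀‖ ^ κ * |(C * s₀ ^ b).re| ≤
        Real.circleAverage (fun s : ℂ => ‖s‖ ^ κ * |(C * s ^ b).re|) s₀ r := by
  obtain ⟨ε, hε, hε1, h⟩ := exists_circleAverage_norm_rpow_mul_pow b hκ
  refine ⟨ε, hε, hε1, fun C s₀ r hr0 hr => ?_⟩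
  have hs : 0 < ‖s₀‖ := by
    by_contra hs
    nlinarith [norm_nonneg s₀]
  have hs0 : s₀ ≠ 0 := norm_pos_iff.1 hs
  have hρ0 : 0 < r / ‖s₀‖ := by positivity
  obtain ⟨m, hm1, hm⟩ := h (r / ‖s₀‖) hρ0 (by rwa [div_le_iff₀ hs])
  -- The scaling `s ↦ s₀ s` reduces to circles about `1`; the factor `s₀ ^ b` is absorbed into the
  -- constant `C`.
  have hmap : ∀ θ : ℝ, circleMap s₀ r (θ + arg s₀) = s₀ * circleMap 1 (r / ‖s₀‖) θ := by
    intro θ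
    simp only [circleMap]
    rw [mul_add, mul_one]
    congr 1
    conv_rhs => rw [← Complex.norm_mul_exp_arg_mul_I s₀]
    push_cast
    rw [add_mul, Complex.exp_add]
    simp only [Complex.norm_mul, Complex.norm_real, norm_norm, Complex.norm_exp_ofReal_mul_I,
      mul_one]
    have : ((‖s₀‖ : ℝ) : ℂ) ≠ 0 := by exact_mod_cast hs.ne'
    field_simp
  have hscale : Real.circleAverage (fun s : ℂ => ‖s‖ ^ κ * |(C * s ^ b).re|) s₀ r =
      ‖s₀‖ ^ κ * Real.circleAverage (fun s : ℂ => ‖s‖ ^ κ * |(C * s₀ ^ b * s ^ b).re|) 1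
        (r / ‖s₀‖) := by
    rw [Real.circleAverage_eq_integral_add (arg s₀), Real.circleAverage_def, smul_eq_mul,
      smul_eq_mul, mul_left_comm]
    congr 1
    rw [← intervalIntegral.integral_const_mul]
    refine intervalIntegral.integral_congr fun θ _ => ?_
    rw [hmap, norm_mul, Real.mul_rpow (norm_nonneg _) (norm_nonneg _), mul_pow]
    ring_nf
  rw [hscale]
  gcongr
  set D := C * s₀ ^ b
  have hg : Continuous fun s : ℂ => ((‖s‖ ^ κ : ℝ) : ℂ) * s ^ b :=
    continuous_norm_rpow_mul_pow b hκ
  have e1 : Real.circleAverage (fun s : ℂ => ‖s‖ ^ κ * (D * s ^ b).re) 1 (r / ‖s₀‖) =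
      m * D.re := by
    have e2 : (fun s : ℂ => ‖s‖ ^ κ * (D * s ^ b).re) =
        (Complex.reCLM ∘ fun s : ℂ => D • (((‖s‖ ^ κ : ℝ) : ℂ) * s ^ b)) := by
      ext s
      simp only [Function.comp, Complex.reCLM_apply, smul_eq_mul]
      rw [mul_left_comm, Complex.re_ofReal_mul]
    rw [e2, Complex.reCLM.circleAverage_comp_comm 
      (circleIntegrable_of_continuous (f := fun s : ℂ => D • (((‖s‖ ^ κ : ℝ) : ℂ) * s ^ b))
        (hg.const_smul D) _ _),
      Real.circleAverage_fun_smul, hm]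
    simp [mul_comm]
  -- That `m` is real matters here: it gives `Re (D m) = m Re D`, so the mean without absolute
  -- values is known exactly.
  calc |D.re| ≤ m * |D.re| := le_mul_of_one_le_left (abs_nonneg _) hm1
    _ = |Real.circleAverage (fun s : ℂ => ‖s‖ ^ κ * (D * s ^ b).re) 1 (r / ‖s₀‖)| := by
      rw [e1, abs_mul, abs_of_nonneg (by linarith : 0 ≤ m)]
    _ ≤ _ := Real.abs_circleAverage_le_circleAverage_abs
    _ = _ := by
      congr 1
      ext s
      simp only [Pi.abs_apply, abs_mul]
      rw [abs_of_nonneg (by positivity : 0 ≤ ‖s‖ ^ κ)]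

/-- Jensen's inequality for circle averages of powers. -/
theorem circleAverage_rpow_le {Q : ℝ} (hQ : 1 ≤ Q) {g : ℂ → ℝ} (hg : Continuous g)
    (hg0 : ∀ s, 0 ≤ g s) (c : ℂ) (r : ℝ) :
    Real.circleAverage g c r ^ Q ≤ Real.circleAverage (fun s => g s ^ Q) c r := by
  rw [Real.circleAverage_eq_intervalAverage, Real.circleAverage_eq_intervalAverage]
  have hgQ : Continuous fun θ => g (circleMap c r θ) ^ Q :=
    (hg.comp (continuous_circleMap c r)).rpow_const fun _ => Or.inr (by linarith)
  have hvol : volume (uIoc 0 (2 * Real.pi)) ≠ 0 := by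
    rw [uIoc_of_le (by positivity), Real.volume_Ioc]
    simp [Real.pi_pos]
  have hvol' : volume (uIoc 0 (2 * Real.pi)) ≠ ∞ := by
    rw [uIoc_of_le (by positivity), Real.volume_Ioc]
    exact ENNReal.ofReal_ne_top
  exact ConvexOn.map_set_average_le (convexOn_rpow hQ)
    (Real.continuous_rpow_const (by linarith)).continuousOn isClosed_Ici hvol hvol'
    (Filter.Eventually.of_forall fun θ => hg0 _)
    (intervalIntegrable_iff.1 ((hg.comp (continuous_circleMap c r)).intervalIntegrable _ _))
    (intervalIntegrable_iff.1 (hgQ.intervalIntegrable _ _))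

/-- A continuous function on the closed unit disk which has the local sub-mean value property in the
open disk is bounded by its bound on the unit circle. -/
theorem le_of_local_submean {H : ℂ → ℝ} (hH : ContinuousOn H (closedBall 0 1))
    (hsub : ∀ z ∈ ball (0 : ℂ) 1, ∃ δ > 0, closedBall z δ ⊆ ball 0 1 ∧
      H z ≤ Real.circleAverage H z δ)
    {M : ℝ} (hM : ∀ z ∈ sphere (0 : ℂ) 1, H z ≤ M) {z : ℂ} (hz : z ∈ closedBall (0 : ℂ) 1) :
    H z ≤ M := by
  apply le_of_forall_pos_le_add
  intro η hη
  -- The perturbation `η‖z‖²` has mean exceeding its central value by `ηδ²`, which makes the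
  -- sub-mean inequality strict and excludes an interior maximum.
  set G : ℂ → ℝ := fun z => H z + η * ‖z‖ ^ 2 with hG
  have hGc : ContinuousOn G (closedBall 0 1) := hH.add (by fun_prop)
  obtain ⟨z₀, hz₀, hmax⟩ := (isCompact_closedBall (0 : ℂ) 1).exists_isMaxOn ⟨z, hz⟩ hGc
  have hle : H z ≤ G z₀ := by
    have := hmax hz
    simp only [hG, mem_ofPred_eq] at this ⊢
    nlinarith [sq_nonneg ‖z‖]
  rcases (mem_closedBall.1 hz₀).lt_or_eq with hlt | heq
  · exfalso
    obtain ⟨δ, hδ, hsubset, hmean⟩ := hsub z₀ hlt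
    have hsph : sphere z₀ |δ| ⊆ closedBall 0 1 := by
      rw [abs_of_pos hδ]
      exact sphere_subset_closedBall.trans (hsubset.trans ball_subset_closedBall)
    have hHi : CircleIntegrable H z₀ δ := (hH.mono hsph).circleIntegrable'
    have hni : CircleIntegrable (fun z : ℂ => η * ‖z‖ ^ 2) z₀ δ :=
      circleIntegrable_of_continuous (by fun_prop) _ _
    have h1 : Real.circleAverage G z₀ δ ≤ G z₀ :=
      Real.circleAverage_mono_on_of_le_circle (hHi.add hni) fun x hx => hmax (hsph hx)
    have h2 : Real.circleAverage G z₀ δ =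
        Real.circleAverage H z₀ δ + Real.circleAverage (fun z : ℂ => η * ‖z‖ ^ 2) z₀ δ :=
      Real.circleAverage_fun_add hHi hni
    have h3 : Real.circleAverage (fun z : ℂ => η * ‖z‖ ^ 2) z₀ δ = η * (‖z₀‖ ^ 2 + δ ^ 2) := by
      have hd : Real.circleAverage (fun z : ℂ => 2 * (starRingEnd ℂ) z₀ * (z - z₀)) z₀ δ = 0 := by
        have hdc : DiffContOnCl ℂ (fun z : ℂ => 2 * (starRingEnd ℂ) z₀ * (z - z₀)) (ball z₀ |δ|) :=
          Differentiable.diffContOnCl (by fun_prop)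
        rw [hdc.circleAverage]
        simp
      have hd' : Real.circleAverage (fun z : ℂ => (2 * (starRingEnd ℂ) z₀ * (z - z₀)).re) z₀ δ
          = 0 := by
        have := Complex.reCLM.circleAverage_comp_comm
          (circleIntegrable_of_continuous (f := fun z : ℂ => 2 * (starRingEnd ℂ) z₀ * (z - z₀))
            (by fun_prop) z₀ δ)
        rw [hd] at this
        simpa [Function.comp_def] using this
      have e : ∀ x ∈ sphere z₀ |δ|, η * ‖x‖ ^ 2 =
          η * (‖z₀‖ ^ 2 + δ ^ 2) + η • (2 * (starRingEnd ℂ) z₀ * (x - z₀)).re := by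
        intro x hx
        rw [mem_sphere, dist_eq_norm, abs_of_pos hδ] at hx
        rw [← hx, smul_eq_mul, ← mul_add]
        congr 1
        simp only [← Complex.normSq_eq_norm_sq, Complex.normSq_apply, Complex.mul_re,
          Complex.mul_im, Complex.sub_re, Complex.sub_im, Complex.conj_re, Complex.conj_im]
        simp
        ring
      rw [Real.circleAverage_congr_sphere e, Real.circleAverage_fun_add, Real.circleAverage_const,
        Real.circleAverage_fun_smul, hd']
      · simp
      · exact circleIntegrable_const _ _ _
      · exact circleIntegrable_of_continuous (by fun_prop) _ _
    have h4 : G z₀ = H z₀ + η * ‖z₀‖ ^ 2 := rfl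
    nlinarith [mul_pos hη (pow_pos hδ 2)]
  · have h1 := hM z₀ (mem_sphere.2 heq)
    rw [dist_zero_right] at heq
    have h4 : G z₀ = H z₀ + η * ‖z₀‖ ^ 2 := rfl
    rw [heq] at h4
    linarith

end Submean

/-! ### The normalized kernel integral and its maximum principle in `z`. -/

/-- The `Q`-th power of the `L^Q` norm of the kernel representing the `(b+1)`-st derivative, after
the Möbius change of variable and without its singular factor:
`∫ |w + z| ^ (2 (Q - 1)) |Re (c w (w + z) ^ b)| ^ Q` over `w = e ^ {it}`. -/
noncomputable def circlePowerIntegral (b : ℕ) (Q : ℝ) (c z : ℂ) : ℝ :=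
  ∫ t in (0 : ℝ)..2 * Real.pi, ‖circleMap 0 1 t + z‖ ^ (2 * (Q - 1)) *
    |(c * circleMap 0 1 t * (circleMap 0 1 t + z) ^ b).re| ^ Q

section PowerIntegral

variable {b : ℕ} {Q : ℝ}

theorem continuous_powerIntegrand {X : Type*} [TopologicalSpace X] {c w z : X → ℂ}
    (hc : Continuous c) (hw : Continuous w) (hz : Continuous z) (b : ℕ) (hQ : 1 ≤ Q) :
    Continuous fun x => ‖w x + z x‖ ^ (2 * (Q - 1)) * |(c x * w x * (w x + z x) ^ b).re| ^ Q :=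
  ((hw.add hz).norm.rpow_const fun _ => Or.inr (by linarith)).mul
    ((Complex.continuous_re.comp ((hc.mul hw).mul ((hw.add hz).pow b))).abs.rpow_const
      fun _ => Or.inr (by linarith))

theorem continuous_circlePowerIntegral (b : ℕ) (hQ : 1 ≤ Q) :
    Continuous fun x : ℂ × ℂ => circlePowerIntegral b Q x.1 x.2 :=
  intervalIntegral.continuous_parametric_intervalIntegral_of_continuous'
    (continuous_powerIntegrand (by fun_prop) (by fun_prop) (by fun_prop) b hQ) 0 (2 * Real.pi)

theorem circlePowerIntegral_nonneg (c z : ℂ) : 0 ≤ circlePowerIntegral b Q c z :=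
  intervalIntegral.integral_nonneg (by positivity) fun _ _ => by positivity

theorem circleAverage_intervalIntegral {Ψ : ℝ → ℂ → ℝ} (hΨ : Continuous fun x : ℝ × ℂ => Ψ x.1 x.2)
    (a b : ℝ) (z : ℂ) (r : ℝ) :
    Real.circleAverage (fun s => ∫ t in a..b, Ψ t s) z r =
      ∫ t in a..b, Real.circleAverage (Ψ t) z r := by
  simp only [Real.circleAverage_def, smul_eq_mul]
  rw [intervalIntegral.integral_const_mul, intervalIntegral_intervalIntegral_swap]
  have hc : Continuous (Function.uncurry fun (x : ℝ) (y : ℝ) => Ψ y (circleMap z r x)) :=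
    hΨ.comp (by fun_prop : Continuous fun x : ℝ × ℝ => (x.2, circleMap z r x.1))
  exact (hc.continuousOn.integrableOn_compact
    (isCompact_uIcc.prod isCompact_uIcc)).mono_set (prod_mono uIoc_subset_uIcc uIoc_subset_uIcc)

theorem continuous_circleAverage {Ψ : ℝ → ℂ → ℝ} (hΨ : Continuous fun x : ℝ × ℂ => Ψ x.1 x.2)
    (z : ℂ) (r : ℝ) : Continuous fun t => Real.circleAverage (Ψ t) z r := by
  simp only [Real.circleAverage_def]
  exact (intervalIntegral.continuous_parametric_intervalIntegral_of_continuous' (μ := volume)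
    (f := fun t θ => Ψ t (circleMap z r θ))
    (hΨ.comp (by fun_prop : Continuous fun x : ℝ × ℝ => (x.1, circleMap z r x.2))) 0 _).const_smul
    (2 * Real.pi)⁻¹

/-- The choice `κ = 2(Q - 1)/Q` makes the integrand a `Q`-th power of a function with the sub-mean
property; Jensen's inequality preserves that property. -/
theorem exists_powerIntegrand_le_circleAverage (b : ℕ) (hQ : 1 ≤ Q) :
    ∃ ε > 0, ε < 1 ∧ ∀ (C s₀ : ℂ) (r : ℝ), 0 < r → r ≤ ε * ‖s₀‖ →
      ‖s₀‖ ^ (2 * (Q - 1)) * |(C * s₀ ^ b).re| ^ Q ≤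
        Real.circleAverage (fun s => ‖s‖ ^ (2 * (Q - 1)) * |(C * s ^ b).re| ^ Q) s₀ r := by
  have hQ0 : 0 < Q := by linarith
  have hκ : 0 ≤ 2 * (Q - 1) / Q := by
    have : 0 ≤ Q - 1 := by linarith
    positivity
  obtain ⟨ε, hε, hε1, h⟩ := exists_le_circleAverage_norm_rpow_mul_abs_re b hκ
  refine ⟨ε, hε, hε1, fun C s₀ r hr0 hr => ?_⟩
  have hpow : ∀ s : ℂ, (‖s‖ ^ (2 * (Q - 1) / Q) * |(C * s ^ b).re|) ^ Q
      = ‖s‖ ^ (2 * (Q - 1)) * |(C * s ^ b).re| ^ Q := by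
    intro s
    rw [Real.mul_rpow (by positivity) (by positivity), ← Real.rpow_mul (norm_nonneg _),
      div_mul_cancel₀ _ hQ0.ne']
  have hcont := continuous_norm_rpow_mul_abs_re b hκ C
  have h2 := circleAverage_rpow_le hQ hcont (fun s => by positivity) s₀ r
  have h3 := (Real.rpow_le_rpow (by positivity) (h C s₀ r hr0 hr) hQ0.le).trans h2
  simpa only [hpow] using h3

/-- The pointwise inequality is integrated over `w` by Fubini. One radius serves all `w` on the
circle, because `‖w + z₀‖ ≥ 1 - ‖z₀‖`. -/
theorem exists_circlePowerIntegral_le_circleAverage (b : ℕ) (hQ : 1 ≤ Q) :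
    ∃ ε > 0, ε < 1 ∧ ∀ (c z₀ : ℂ) (r : ℝ), 0 < r → r ≤ ε * (1 - ‖z₀‖) →
      circlePowerIntegral b Q c z₀ ≤ Real.circleAverage (circlePowerIntegral b Q c) z₀ r := by
  obtain ⟨ε, hε, hε1, h⟩ := exists_powerIntegrand_le_circleAverage b hQ
  refine ⟨ε, hε, hε1, fun c z₀ r hr0 hr => ?_⟩
  obtain ⟨Ψ, hΨ⟩ : ∃ Ψ : ℝ → ℂ → ℝ, Ψ = fun t z => ‖circleMap 0 1 t + z‖ ^ (2 * (Q - 1)) *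
    |(c * circleMap 0 1 t * (circleMap 0 1 t + z) ^ b).re| ^ Q := ⟨_, rfl⟩
  have hpt : ∀ t, Ψ t z₀ ≤ Real.circleAverage (Ψ t) z₀ r := by
    intro t
    have hs : 1 - ‖z₀‖ ≤ ‖circleMap 0 1 t + z₀‖ := by
      have := norm_sub_le_norm_add (circleMap 0 1 t) z₀
      simpa using this
    have h1 := h (c * circleMap 0 1 t) (circleMap 0 1 t + z₀) r hr0
      (hr.trans (by gcongr))
    rw [← Real.circleAverage_map_add_const] at h1
    rw [← Real.circleAverage_map_add_const]
    simp only [hΨ]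
    refine h1.trans (le_of_eq ?_)
    congr 1
    ext z
    rw [add_left_comm z]
  have hcont : Continuous fun x : ℝ × ℂ => Ψ x.1 x.2 := by
    rw [hΨ]
    exact continuous_powerIntegrand (by fun_prop) (by fun_prop) (by fun_prop) b hQ
  have hJ : circlePowerIntegral b Q c = fun z => ∫ t in (0 : ℝ)..2 * Real.pi, Ψ t z := by
    rw [hΨ]; rfl
  rw [hJ, circleAverage_intervalIntegral hcont]
  refine intervalIntegral.integral_mono_on (by positivity) ?_ ?_ fun t _ => hpt t
  · exact (hcont.comp (by fun_prop : Continuous fun t : ℝ => (t, z₀))).intervalIntegrable _ _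
  · exact (continuous_circleAverage hcont z₀ r).intervalIntegrable _ _

theorem circlePowerIntegral_le_of_sphere (hQ : 1 ≤ Q) {c : ℂ} {M : ℝ}
    (hM : ∀ z ∈ sphere (0 : ℂ) 1, circlePowerIntegral b Q c z ≤ M) {z : ℂ}
    (hz : z ∈ closedBall (0 : ℂ) 1) : circlePowerIntegral b Q c z ≤ M := by
  refine le_of_local_submean ?_ (fun z₀ hz₀ => ?_) hM hz
  · exact ((continuous_circlePowerIntegral b hQ).comp
      (by fun_prop : Continuous fun z : ℂ => (c, z))).continuousOn
  · obtain ⟨ε, hε, hε1, h⟩ := exists_circlePowerIntegral_le_circleAverage b hQ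
    have hz1 : 0 < 1 - ‖z₀‖ := by rw [mem_ball_zero_iff] at hz₀; linarith
    refine ⟨ε * (1 - ‖z₀‖), by positivity, ?_, h c z₀ _ (by positivity) le_rfl⟩
    intro x hx
    rw [mem_closedBall, dist_eq_norm] at hx
    rw [mem_ball_zero_iff]
    have := norm_le_norm_add_norm_sub' x z₀
    nlinarith

/-- Replacing `w` by `l w` gives `c (l w)(l w + l)^b = c l^(b+1) w (w + 1)^b`, so a boundary point
`z = l` only changes the phase `c`. -/
theorem circlePowerIntegral_rotate {l : ℂ} (hl : ‖l‖ = 1) (c : ℂ) :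
    circlePowerIntegral b Q c l = circlePowerIntegral b Q (c * l ^ (b + 1)) 1 := by
  have key : ∀ t : ℝ, circleMap 0 1 (t + arg l) = l * circleMap 0 1 t := by
    intro t
    have hl' := Complex.norm_mul_exp_arg_mul_I l
    rw [hl, ofReal_one, one_mul] at hl'
    conv_rhs => rw [← hl']
    simp only [circleMap]
    push_cast
    rw [add_mul, Complex.exp_add]
    ring
  set f : ℂ → ℝ := fun w => ‖w + l‖ ^ (2 * (Q - 1)) * |(c * w * (w + l) ^ b).re| ^ Q with hf
  have h1 : circlePowerIntegral b Q c l = (2 * Real.pi) * Real.circleAverage f 0 1 := by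
    rw [Real.circleAverage_def, smul_eq_mul, mul_inv_cancel_left₀ (by positivity)]
    rfl
  rw [h1, Real.circleAverage_eq_integral_add (arg l), smul_eq_mul,
    mul_inv_cancel_left₀ (by positivity), circlePowerIntegral]
  refine intervalIntegral.integral_congr fun t _ => ?_
  simp only [hf, key]
  have e1 : l * circleMap 0 1 t + l = l * (circleMap 0 1 t + 1) := by ring
  rw [e1, norm_mul, hl, one_mul, mul_pow]
  congr 4
  ring

end PowerIntegral

/-! ### The kernel integral at the boundary point `1`. -/

section Boundary

variable {b : ℕ} {Q : ℝ}

/-- Put `t = 2v - π`. Then `w = -e^(2iv)` and `w + 1 = 2 sin v · e^(i(v - π/2))`, which yields the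
sine power and the phase in `phi`. The powers of two combine `2^(2(Q-1) + bQ)` with the Jacobian
`2`. -/
theorem circlePowerIntegral_exp_one {q : ℝ≥0∞} (hq : 1 ≤ q) (hq' : q ≠ ∞) (b : ℕ) (β : ℝ) :
    circlePowerIntegral b q.toReal (exp (β * I)) 1 =
      2 ^ ((b + 2) * q.toReal - 1) * F (b + 1) q β := by
  have hQ : 1 ≤ q.toReal := by simpa using ENNReal.toReal_mono hq' hq
  have hqi : (q⁻¹).toReal = (q.toReal)⁻¹ := ENNReal.toReal_inv q
  set Q := q.toReal with hQdef
  have hQ0 : 0 < Q := by linarith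
  set g : ℝ → ℝ := fun t => ‖circleMap 0 1 t + 1‖ ^ (2 * (Q - 1)) *
    |(exp (β * I) * circleMap 0 1 t * (circleMap 0 1 t + 1) ^ b).re| ^ Q with hg
  have hper : Function.Periodic g (2 * Real.pi) := by
    intro t
    simp only [hg, periodic_circleMap 0 1 t]
  have h1 : circlePowerIntegral b Q (exp (β * I)) 1 = ∫ t in (-Real.pi)..Real.pi, g t := by
    have := hper.intervalIntegral_add_eq 0 (-Real.pi)
    rw [zero_add, show -Real.pi + 2 * Real.pi = Real.pi by ring] at this
    rw [← this]
    rfl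
  have h2 : ∫ t in (-Real.pi)..Real.pi, g t = 2 * ∫ v in (0 : ℝ)..Real.pi, g (2 * v - Real.pi) := by
    rw [intervalIntegral.integral_comp_mul_sub _ two_ne_zero]
    rw [smul_eq_mul, mul_inv_cancel_left₀ two_ne_zero]
    congr 1 <;> ring
  rw [h1, h2, F, ← intervalIntegral.integral_const_mul, ← intervalIntegral.integral_const_mul]
  refine intervalIntegral.integral_congr fun v hv => ?_
  rw [uIcc_of_le Real.pi_pos.le] at hv
  have hsin : 0 ≤ Real.sin v := Real.sin_nonneg_of_mem_Icc hv
  have hw : circleMap 0 1 (2 * v - Real.pi) = -(exp (v * I) * exp (v * I)) := by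
    simp only [circleMap]
    push_cast
    rw [sub_mul, Complex.exp_sub, Complex.exp_pi_mul_I, ← Complex.exp_add]
    simp only [one_mul, zero_add]
    rw [div_neg, div_one]
    ring_nf
  have hw1 : circleMap 0 1 (2 * v - Real.pi) + 1 =
      ((2 * Real.sin v : ℝ) : ℂ) * (exp (v * I) * exp (-(Real.pi / 2 : ℝ) * I)) := by
    rw [hw]
    have e1 : exp (-(Real.pi / 2 : ℝ) * I) = -I := by
      rw [neg_mul, Complex.exp_neg]
      push_cast
      rw [Complex.exp_pi_div_two_mul_I, Complex.inv_I]
    rw [e1, Complex.exp_mul_I, ← Complex.ofReal_cos, ← Complex.ofReal_sin]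
    have hsc := Real.sin_sq_add_cos_sq v
    generalize Real.sin v = x at hsc ⊢
    generalize Real.cos v = y at hsc ⊢
    apply Complex.ext <;> simp <;> linarith
  have hn1 : ‖circleMap 0 1 (2 * v - Real.pi) + 1‖ = 2 * Real.sin v := by
    rw [hw1, norm_mul, norm_mul, ← ofReal_neg, Complex.norm_exp_ofReal_mul_I,
      Complex.norm_exp_ofReal_mul_I, Complex.norm_real, Real.norm_of_nonneg (by positivity)]
    ring
  have hre : |(exp (β * I) * circleMap 0 1 (2 * v - Real.pi) *
      (circleMap 0 1 (2 * v - Real.pi) + 1) ^ b).re| = (2 * Real.sin v) ^ b *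
      |Real.cos (((b + 1 : ℕ) + 1 : ℝ) * v + β - Real.pi / 2 * ((b + 1 : ℕ) - 1 : ℝ))| := by
    have e : exp (β * I) * circleMap 0 1 (2 * v - Real.pi) *
        (circleMap 0 1 (2 * v - Real.pi) + 1) ^ b = (((2 * Real.sin v) ^ b : ℝ) : ℂ) *
        -exp ((((b + 1 : ℕ) + 1 : ℝ) * v + β - Real.pi / 2 * ((b + 1 : ℕ) - 1 : ℝ) : ℝ) * I) := by
      rw [hw1, hw, mul_pow, mul_pow, ← Complex.exp_nat_mul, ← Complex.exp_nat_mul]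
      rw [← Complex.exp_add, ← Complex.exp_add, mul_neg, ← Complex.exp_add]
      rw [neg_mul, mul_left_comm, ← Complex.exp_add, ofReal_pow, mul_neg]
      congr 3
      push_cast
      ring
    rw [e, Complex.re_ofReal_mul, Complex.neg_re, abs_mul, abs_neg, Complex.exp_ofReal_mul_I_re,
      abs_of_nonneg (by positivity)]
  have hx1 : 0 ≤ 2 * (Q - 1) := by linarith
  simp only [hg]
  rw [hre, hn1, phi, abs_mul, abs_of_nonneg (Real.rpow_nonneg hsin _),
    Real.mul_rpow (by positivity) (abs_nonneg _), Real.mul_rpow (by positivity) (abs_nonneg _),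
    ← Real.rpow_natCast, ← Real.rpow_mul (by positivity), ← Real.rpow_mul hsin, ← mul_assoc,
    ← mul_assoc, ← mul_assoc, mul_assoc 2, ← Real.rpow_add_of_nonneg (by positivity) hx1
      (by positivity)]
  have he : ((b + 1 : ℕ) + 1 - 2 * (q⁻¹).toReal : ℝ) * Q = 2 * (Q - 1) + b * Q := by
    rw [hqi]
    push_cast
    field_simp
    ring
  rw [he, Real.mul_rpow zero_le_two hsin, ← mul_assoc]
  congr 2
  rw [show ((b + 2 : ℝ) * Q - 1) = 1 + (2 * (Q - 1) + b * Q) by ring,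
    Real.rpow_add two_pos 1, Real.rpow_one]

theorem circlePowerIntegral_neg (c z : ℂ) :
    circlePowerIntegral b Q (-c) z = circlePowerIntegral b Q c z := by
  simp only [circlePowerIntegral, neg_mul, Complex.neg_re, abs_neg]

theorem circlePowerIntegral_conj (c : ℂ) :
    circlePowerIntegral b Q ((starRingEnd ℂ) c) 1 = circlePowerIntegral b Q c 1 := by
  unfold circlePowerIntegral
  have h2 := intervalIntegral.integral_comp_sub_left (a := 0) (b := 2 * Real.pi)
    (fun t => ‖circleMap 0 1 t + 1‖ ^ (2 * (Q - 1)) *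
      |(c * circleMap 0 1 t * (circleMap 0 1 t + 1) ^ b).re| ^ Q) (2 * Real.pi)
  rw [sub_self, sub_zero] at h2
  rw [← h2]
  refine intervalIntegral.integral_congr fun t _ => ?_
  have hw : circleMap 0 1 (2 * Real.pi - t) = (starRingEnd ℂ) (circleMap 0 1 t) := by
    simp only [circleMap, map_add, map_zero, map_one, map_mul, ofReal_one, ← Complex.exp_conj,
      Complex.conj_I, Complex.conj_ofReal]
    congr 2
    push_cast
    rw [sub_mul, Complex.exp_sub, Complex.exp_two_pi_mul_I, mul_neg, Complex.exp_neg, one_div]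
  have e1 : (starRingEnd ℂ) (circleMap 0 1 t) + 1 = (starRingEnd ℂ) (circleMap 0 1 t + 1) := by simp
  simp only [hw]
  rw [e1, Complex.norm_conj]
  have e2 : c * (starRingEnd ℂ) (circleMap 0 1 t) * (starRingEnd ℂ) (circleMap 0 1 t + 1) ^ b
      = (starRingEnd ℂ) ((starRingEnd ℂ) c * circleMap 0 1 t * (circleMap 0 1 t + 1) ^ b) := by
    simp
  rw [e2, Complex.conj_re]

/-- The symmetries `c ↦ -c` and `c ↦ c̄` move any unimodular phase into the first quadrant; hence
the range `[0, π/2]` of `β`. -/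
theorem exists_circlePowerIntegral_exp_eq {c : ℂ} (hc : ‖c‖ = 1) :
    ∃ β ∈ Icc 0 (Real.pi / 2),
      circlePowerIntegral b Q c 1 = circlePowerIntegral b Q (exp (β * I)) 1 := by
  have main : ∀ d : ℂ, ‖d‖ = 1 → 0 ≤ d.re → 0 ≤ d.im → ∃ β ∈ Icc 0 (Real.pi / 2),
      circlePowerIntegral b Q d 1 = circlePowerIntegral b Q (exp (β * I)) 1 := by
    intro d hd hr hi
    refine ⟨arg d, ⟨arg_nonneg_iff.2 hi, arg_le_pi_div_two_iff.2 (Or.inl hr)⟩, ?_⟩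
    have := Complex.norm_mul_exp_arg_mul_I d
    rw [hd, ofReal_one, one_mul] at this
    rw [this]
  rcases le_total 0 c.re with hr | hr <;> rcases le_total 0 c.im with hi | hi
  · exact main c hc hr hi
  · rw [← circlePowerIntegral_conj]
    exact main _ (by simpa) (by simpa) (by simpa)
  · rw [← circlePowerIntegral_conj, ← circlePowerIntegral_neg]
    exact main _ (by simpa) (by simpa) (by simpa)
  · rw [← circlePowerIntegral_neg]
    exact main _ (by simpa) (by simpa) (by simpa)

end Boundary

/-! ### Attainment of the maximum over the phase. -/

section FRoot

variable {q : ℝ≥0∞}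

theorem F_nonneg (n : ℕ) (q : ℝ≥0∞) (β : ℝ) : 0 ≤ F n q β :=
  intervalIntegral.integral_nonneg Real.pi_pos.le fun _ _ => by positivity

theorem FRoot_eq_circlePowerIntegral (hq : 1 ≤ q) (hq' : q ≠ ∞) (b : ℕ) (β : ℝ) :
    circlePowerIntegral b q.toReal (exp (β * I)) 1 ^ (1 / q.toReal) =
      2 ^ (((b + 1 : ℕ) : ℝ) + 1 - (q⁻¹).toReal) * FRoot (b + 1) q β := by
  have hQ : 1 ≤ q.toReal := by simpa using ENNReal.toReal_mono hq' hq
  rw [circlePowerIntegral_exp_one hq hq', FRoot, if_neg hq',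
    Real.mul_rpow (by positivity) (F_nonneg _ _ _), ← Real.rpow_mul zero_le_two,
    ENNReal.toReal_inv]
  congr 2
  push_cast
  field_simp
  ring

theorem continuous_FRoot (hq : 1 ≤ q) (hq' : q ≠ ∞) (b : ℕ) : Continuous (FRoot (b + 1) q) := by
  have hQ : 1 ≤ q.toReal := by simpa using ENNReal.toReal_mono hq' hq
  have h : FRoot (b + 1) q = fun β : ℝ => (2 ^ (((b + 1 : ℕ) : ℝ) + 1 - (q⁻¹).toReal))⁻¹ *
      circlePowerIntegral b q.toReal (exp (β * I)) 1 ^ (1 / q.toReal) := by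
    ext β
    rw [FRoot_eq_circlePowerIntegral hq hq', inv_mul_cancel_left₀ (by positivity)]
  rw [h]
  refine continuous_const.mul (Continuous.rpow_const ?_ fun _ => Or.inr (by positivity))
  exact (continuous_circlePowerIntegral b hQ).comp
    (by fun_prop : Continuous fun β : ℝ => (exp (β * I), (1 : ℂ)))

theorem FRoot_top_le (n : ℕ) (β : ℝ) : FRoot n ∞ β ≤ 1 := by
  rw [FRoot, if_pos rfl]
  refine csSup_le ((nonempty_Icc.2 Real.pi_pos.le).image _) ?_
  rintro _ ⟨v, hv, rfl⟩
  have h0 := Real.sin_nonneg_of_mem_Icc hv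
  simp only [phi, ENNReal.inv_top, ENNReal.toReal_zero, mul_zero, sub_zero, abs_mul]
  rw [abs_of_nonneg (Real.rpow_nonneg h0 _)]
  exact mul_le_one₀ (Real.rpow_le_one h0 (Real.sin_le_one v) (by positivity)) (abs_nonneg _)
    (Real.abs_cos_le_one _)

/-- At `v = π/2` and `β = 0` the angle is `π` for every `n`, so both factors of `phi` have modulus
one. -/
theorem FRoot_top_zero (n : ℕ) : FRoot n ∞ 0 = 1 := by
  refine le_antisymm (FRoot_top_le n 0) ?_
  rw [FRoot, if_pos rfl]
  refine le_csSup ⟨1, ?_⟩ ⟨Real.pi / 2, ⟨by positivity, by linarith [Real.pi_pos]⟩, ?_⟩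
  · rintro _ ⟨v, hv, rfl⟩
    have h0 := Real.sin_nonneg_of_mem_Icc hv
    simp only [phi, ENNReal.inv_top, ENNReal.toReal_zero, mul_zero, sub_zero, abs_mul]
    rw [abs_of_nonneg (Real.rpow_nonneg h0 _)]
    exact mul_le_one₀ (Real.rpow_le_one h0 (Real.sin_le_one v) (by positivity)) (abs_nonneg _)
      (Real.abs_cos_le_one _)
  · have : ((n : ℝ) + 1) * (Real.pi / 2) + 0 - Real.pi / 2 * ((n : ℝ) - 1) = Real.pi := by ring
    simp only [phi, this]
    simp

theorem exists_isMaxOn_FRoot (hq : 1 ≤ q) (b : ℕ) :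
    ∃ β₀ ∈ Icc (0 : ℝ) (Real.pi / 2), IsMaxOn (FRoot (b + 1) q) (Icc 0 (Real.pi / 2)) β₀ := by
  have hpi : (0 : ℝ) ≤ Real.pi / 2 := by positivity
  by_cases hq' : q = ∞
  · subst hq'
    refine ⟨0, ⟨le_rfl, hpi⟩, fun β _ => ?_⟩
    rw [mem_ofPred_eq, FRoot_top_zero]
    exact FRoot_top_le _ β
  · exact isCompact_Icc.exists_isMaxOn (nonempty_Icc.2 hpi) (continuous_FRoot hq hq' b).continuousOn

theorem FRoot_le_sSup (hq : 1 ≤ q) (b : ℕ) {β : ℝ} (hβ : β ∈ Icc 0 (Real.pi / 2)) :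
    FRoot (b + 1) q β ≤ sSup (FRoot (b + 1) q '' Icc 0 (Real.pi / 2)) := by
  obtain ⟨β₀, _, h⟩ := exists_isMaxOn_FRoot hq b
  refine le_csSup ⟨FRoot (b + 1) q β₀, ?_⟩ (mem_image_of_mem _ hβ)
  rintro _ ⟨x, hx, rfl⟩
  exact h hx

theorem sharpConst_top (b : ℕ) :
    sharpConst (b + 1) ∞ = ((b + 1).factorial : ℝ) / Real.pi * 2 ^ (b + 2) := by
  have h : sSup (FRoot (b + 1) ∞ '' Icc 0 (Real.pi / 2)) = 1 := by
    refine le_antisymm (csSup_le ⟨_, mem_image_of_mem _ (left_mem_Icc.2 (by positivity))⟩ ?_) ?_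
    · rintro _ ⟨x, _, rfl⟩
      exact FRoot_top_le _ x
    · rw [← FRoot_top_zero (b + 1)]
      exact FRoot_le_sSup le_top b (left_mem_Icc.2 (by positivity))
  rw [sharpConst, h, mul_one]
  congr 1
  rw [ENNReal.inv_top, ENNReal.toReal_zero, sub_zero, ← Real.rpow_natCast]
  congr 1
  push_cast
  ring

/-- The extremal problem for the kernel norms is solved on the boundary. -/
theorem circlePowerIntegral_rpow_le (hq : 1 ≤ q) (hq' : q ≠ ∞) (b : ℕ) {c z : ℂ} (hc : ‖c‖ = 1)
    (hz : ‖z‖ ≤ 1) :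
    ((b + 1).factorial : ℝ) / Real.pi * circlePowerIntegral b q.toReal c z ^ (1 / q.toReal) ≤
      sharpConst (b + 1) q := by
  have hQ : 1 ≤ q.toReal := by simpa using ENNReal.toReal_mono hq' hq
  set S := 2 ^ (((b + 1 : ℕ) : ℝ) + 1 - (q⁻¹).toReal) *
    sSup (FRoot (b + 1) q '' Icc 0 (Real.pi / 2)) with hS
  have hsph : ∀ l ∈ sphere (0 : ℂ) 1,
      circlePowerIntegral b q.toReal c l ^ (1 / q.toReal) ≤ S := by
    intro l hl
    rw [mem_sphere_zero_iff_norm] at hl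
    rw [circlePowerIntegral_rotate hl]
    obtain ⟨β, hβ, h⟩ := exists_circlePowerIntegral_exp_eq (b := b) (Q := q.toReal)
      (c := c * l ^ (b + 1)) (by simp [hc, hl])
    rw [h, FRoot_eq_circlePowerIntegral hq hq']
    exact mul_le_mul_of_nonneg_left (FRoot_le_sSup hq b hβ) (by positivity)
  have hS0 : 0 ≤ S := le_trans (Real.rpow_nonneg (circlePowerIntegral_nonneg _ _) _)
    (hsph 1 (by simp))
  have hz' := circlePowerIntegral_le_of_sphere (b := b) hQ (c := c) (M := S ^ q.toReal)
    (fun l hl => by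
      have := Real.rpow_le_rpow (Real.rpow_nonneg (circlePowerIntegral_nonneg _ _) _) (hsph l hl)
        (by linarith : 0 ≤ q.toReal)
      rwa [← Real.rpow_mul (circlePowerIntegral_nonneg _ _), one_div,
        inv_mul_cancel₀ (by linarith), Real.rpow_one] at this) (z := z) (by simpa using hz)
  have hz2 : circlePowerIntegral b q.toReal c z ^ (1 / q.toReal) ≤ S := by
    have := Real.rpow_le_rpow (circlePowerIntegral_nonneg _ _) hz'
      (by positivity : 0 ≤ 1 / q.toReal)
    rwa [← Real.rpow_mul hS0, mul_one_div_cancel (by linarith), Real.rpow_one] at this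
  rw [sharpConst, mul_assoc, ← hS]
  exact mul_le_mul_of_nonneg_left hz2 (by positivity)

end FRoot

/-! ### The Möbius change of variable on the circle. -/

section Moebius

theorem one_add_mul_mem_slitPlane {w z : ℂ} (hw : ‖w‖ = 1) (hz : ‖z‖ < 1) :
    1 + z * w ∈ slitPlane := by
  rw [Complex.mem_slitPlane_iff]
  left
  have h1 : ‖z * w‖ < 1 := by rwa [norm_mul, hw, mul_one]
  have h2 := (neg_le_of_abs_le (Complex.abs_re_le_norm (z * w)))
  rw [Complex.add_re, Complex.one_re]
  linarith

theorem norm_add_pos {w z : ℂ} (hw : ‖w‖ = 1) (hz : ‖z‖ < 1) : 0 < ‖w + z‖ := by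
  have := norm_sub_le_norm_add w z
  linarith

/-- The lift to the real line of the Möbius map `w ↦ (w + z) / (1 + conj z * w)` of the circle. -/
noncomputable def moebiusAngle (z : ℂ) (τ : ℝ) : ℝ := τ + 2 * (log (1 + z * exp (-(τ * I)))).im

variable {z : ℂ}

theorem norm_exp_neg_mul_I (τ : ℝ) : ‖exp (-(τ * I))‖ = 1 := by
  rw [← neg_mul, ← ofReal_neg, Complex.norm_exp_ofReal_mul_I]

theorem hasDerivAt_moebiusAngle (hz : ‖z‖ < 1) (τ : ℝ) :
    HasDerivAt (moebiusAngle z) ((1 - ‖z‖ ^ 2) / ‖circleMap 0 1 τ + z‖ ^ 2) τ := by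
  have hs := one_add_mul_mem_slitPlane (norm_exp_neg_mul_I τ) hz
  set e := exp (-(τ * I)) with he
  have h1 : HasDerivAt (fun x : ℝ => 1 + z * exp (-(x * I))) (z * (e * -I)) τ := by
    have h0 : HasDerivAt (fun x : ℝ => -((x : ℂ) * I)) (-I) τ := by
      refine HasDerivAt.congr_deriv (f' := -(1 * I)) ?_ (by simp)
      exact ((Complex.ofRealCLM.hasDerivAt (x := τ)).mul_const I).neg
    exact ((h0.cexp).const_mul z).const_add 1
  have h2 : HasDerivAt (fun x : ℝ => log (1 + z * exp (-(x * I)))) (z * (e * -I) / (1 + z * e)) τ :=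
    h1.clog_real hs
  have h3 : HasDerivAt (fun x : ℝ => (log (1 + z * exp (-(x * I)))).im)
      (z * (e * -I) / (1 + z * e)).im τ :=
    HasFDerivAt.comp_hasDerivAt (l := Complex.imCLM) τ Complex.imCLM.hasFDerivAt h2
  have h4 := (hasDerivAt_id τ).add (h3.const_mul 2)
  refine HasDerivAt.congr_deriv (f' := _) h4 ?_
  symm
  have hw : circleMap 0 1 τ + z = circleMap 0 1 τ * (1 + z * e) := by
    have : circleMap 0 1 τ * e = 1 := by
      rw [he, circleMap, ofReal_one, one_mul, zero_add, ← Complex.exp_add, add_neg_cancel,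
        Complex.exp_zero]
    linear_combination (-z) * this
  have hn : ‖circleMap 0 1 τ + z‖ = ‖1 + z * e‖ := by
    rw [hw, norm_mul]; simp
  have hzn : ‖z * e‖ = ‖z‖ := by rw [norm_mul, norm_exp_neg_mul_I, mul_one]
  -- With `y = z e^(-iτ)` the claim becomes `1 - 2 Re (y/(1 + y)) = (1 - |y|²)/|1 + y|²`.
  rw [hn, ← hzn, show z * (e * -I) = z * e * -I by ring]
  have hp : 0 < ‖1 + z * e‖ ^ 2 := by
    have := norm_pos_iff.2 (slitPlane_ne_zero hs)
    positivity
  generalize z * e = y at *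
  have hN : ‖1 + y‖ ^ 2 = 1 + 2 * y.re + y.re ^ 2 + y.im ^ 2 := by
    rw [← Complex.normSq_eq_norm_sq, Complex.normSq_apply]
    simp
    ring
  have hY : ‖y‖ ^ 2 = y.re ^ 2 + y.im ^ 2 := by
    rw [← Complex.normSq_eq_norm_sq, Complex.normSq_apply]
    ring
  rw [div_eq_iff hp.ne', Complex.div_im, Complex.normSq_eq_norm_sq, hY]
  generalize ‖1 + y‖ ^ 2 = N at hN hp
  field_simp
  simp
  rw [hN]
  ring

/-- For `s = 1 + z e^(-iτ)` one has `e^(2i Im log s) = s / s̄`, while `e^(iτ) s = w + z` and `s̄ = 1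
+ z̄ w`. -/
theorem circleMap_moebiusAngle (hz : ‖z‖ < 1) (τ : ℝ) :
    circleMap 0 1 (moebiusAngle z τ) =
      (circleMap 0 1 τ + z) / (1 + (starRingEnd ℂ) z * circleMap 0 1 τ) := by
  have hs := slitPlane_ne_zero (one_add_mul_mem_slitPlane (norm_exp_neg_mul_I τ) hz)
  set s := 1 + z * exp (-(τ * I)) with hsdef
  have hcs : (starRingEnd ℂ) s = 1 + (starRingEnd ℂ) z * circleMap 0 1 τ := by
    rw [hsdef]
    simp [circleMap, ← Complex.exp_conj]
  have hcs0 : (starRingEnd ℂ) s ≠ 0 := (map_ne_zero _).2 hs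
  have hws : circleMap 0 1 τ * s = circleMap 0 1 τ + z := by
    have : circleMap 0 1 τ * exp (-(τ * I)) = 1 := by
      rw [circleMap, ofReal_one, one_mul, zero_add, ← Complex.exp_add, add_neg_cancel,
        Complex.exp_zero]
    rw [hsdef]
    linear_combination z * this
  rw [← hcs, ← hws, eq_div_iff hcs0]
  have hL : exp (log s) = s := Complex.exp_log hs
  have hcL : exp ((starRingEnd ℂ) (log s)) = (starRingEnd ℂ) s := by rw [Complex.exp_conj, hL]
  have him : (log s) - (starRingEnd ℂ) (log s) = (2 * (log s).im : ℝ) * I := by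
    apply Complex.ext <;> simp
    ring
  have : circleMap 0 1 (moebiusAngle z τ) = circleMap 0 1 τ * (s / (starRingEnd ℂ) s) := by
    rw [← hcL]
    conv_rhs => rw [← hL]
    rw [Complex.log_exp (Complex.neg_pi_lt_log_im _) (Complex.log_im_le_pi _)]
    rw [← Complex.exp_sub, him]
    simp only [circleMap, moebiusAngle, ← hsdef]
    push_cast
    rw [add_mul, Complex.exp_add]
    simp
  rw [this]
  field_simp

/-- Change of variable by a Möbius map of the unit circle. -/
theorem integral_circleMap_moebius (hz : ‖z‖ < 1) {g : ℂ → ℝ}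
    (hg : ContinuousOn g (sphere 0 1)) :
    ∫ t in (0 : ℝ)..2 * Real.pi, g (circleMap 0 1 t) =
      ∫ t in (0 : ℝ)..2 * Real.pi,
        g ((circleMap 0 1 t + z) / (1 + (starRingEnd ℂ) z * circleMap 0 1 t)) *
          ((1 - ‖z‖ ^ 2) / ‖circleMap 0 1 t + z‖ ^ 2) := by
  have hgc : Continuous fun t => g (circleMap 0 1 t) :=
    hg.comp_continuous (continuous_circleMap 0 1) fun t => by simp
  have hd : Continuous fun t => (1 - ‖z‖ ^ 2) / ‖circleMap 0 1 t + z‖ ^ 2 := by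
    refine continuous_const.div (by fun_prop) fun t => ?_
    have := norm_add_pos (w := circleMap 0 1 t) (by simp) hz
    positivity
  have h := intervalIntegral.integral_comp_mul_deriv (a := 0) (b := 2 * Real.pi)
    (fun x _ => hasDerivAt_moebiusAngle hz x) hd.continuousOn hgc
  have hper : Function.Periodic (fun t => g (circleMap 0 1 t)) (2 * Real.pi) := fun t => by
    simp only [periodic_circleMap 0 1 t]
  -- The logarithmic term is periodic, so the lift advances by exactly one period and the
  -- substitution covers the circle once.
  have hend : moebiusAngle z (2 * Real.pi) = moebiusAngle z 0 + 2 * Real.pi := by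
    simp only [moebiusAngle]
    push_cast
    rw [Complex.exp_neg, Complex.exp_two_pi_mul_I]
    simp
    ring
  have hp := hper.intervalIntegral_add_eq 0 (moebiusAngle z 0)
  rw [zero_add] at hp
  rw [hp, ← hend, ← h]
  refine intervalIntegral.integral_congr fun t _ => ?_
  simp only [Function.comp, circleMap_moebiusAngle hz]

/-- On `|w| = 1`, `1 + z̄ w = w · conj (w + z)` and `ζ - z = (1 - |z|²)/conj (w + z)`. The poles
cancel, leaving a real factor times the conjugate of a polynomial in `z`. -/
theorem kernel_moebius {w : ℂ} (hw : ‖w‖ = 1) (hz : ‖z‖ < 1) (b : ℕ) :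
    (w + z) / (1 + (starRingEnd ℂ) z * w) /
      ((w + z) / (1 + (starRingEnd ℂ) z * w) - z) ^ (b + 2) =
      ((‖w + z‖ ^ 2 / (1 - ‖z‖ ^ 2) ^ (b + 2) : ℝ) : ℂ) *
        (starRingEnd ℂ) (w * (w + z) ^ b) := by
  have hw0 : w ≠ 0 := norm_pos_iff.1 (by rw [hw]; exact one_pos)
  have hww : w * (starRingEnd ℂ) w = 1 := by
    rw [Complex.mul_conj, Complex.normSq_eq_norm_sq, hw]; simp
  have hzz : z * (starRingEnd ℂ) z = ((‖z‖ ^ 2 : ℝ) : ℂ) := by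
    rw [Complex.mul_conj, Complex.normSq_eq_norm_sq]
  have hd : 1 + (starRingEnd ℂ) z * w = w * (starRingEnd ℂ) (w + z) := by
    rw [map_add, mul_add, hww, mul_comm w]
  have hs : w + z ≠ 0 := norm_pos_iff.1 (norm_add_pos hw hz)
  have hcs : (starRingEnd ℂ) (w + z) ≠ 0 := (map_ne_zero _).2 hs
  have hr : ((1 - ‖z‖ ^ 2 : ℝ) : ℂ) ≠ 0 := by
    norm_cast
    nlinarith [norm_nonneg z]
  have hsub : (w + z) / (1 + (starRingEnd ℂ) z * w) - z =
      ((1 - ‖z‖ ^ 2 : ℝ) : ℂ) / (starRingEnd ℂ) (w + z) := by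
    rw [hd]
    field_simp
    rw [ofReal_sub, ← hzz, map_add, ofReal_one]
    linear_combination (-z) * hww
  have hns : ((‖w + z‖ ^ 2 : ℝ) : ℂ) = (w + z) * (starRingEnd ℂ) (w + z) := by
    rw [Complex.mul_conj, Complex.normSq_eq_norm_sq]
  rw [hsub, hd, ofReal_div, ofReal_pow _ (b + 2), hns, div_pow, map_mul, map_pow]
  have hcw : (starRingEnd ℂ) w = w⁻¹ := eq_inv_of_mul_eq_one_right hww
  rw [hcw]
  field_simp
  ring

theorem continuousOn_kernel (hz : ‖z‖ < 1) (b : ℕ) :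
    ContinuousOn (fun ζ : ℂ => ζ / (ζ - z) ^ (b + 2)) (sphere 0 1) := by
  refine continuousOn_id.div (by fun_prop) fun ζ hζ => pow_ne_zero _ ?_
  rw [mem_sphere_zero_iff_norm] at hζ
  rw [sub_ne_zero]
  rintro rfl
  linarith

/-- The `L^Q` norms of the kernels after the Möbius change of variable. -/
theorem integral_abs_re_kernel_rpow (hz : ‖z‖ < 1) {Q : ℝ} (hQ : 1 ≤ Q) (b : ℕ) (a : ℂ) :
    ∫ t in (0 : ℝ)..2 * Real.pi,
      |(a * (circleMap 0 1 t / (circleMap 0 1 t - z) ^ (b + 2))).re| ^ Q =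
      (1 - ‖z‖ ^ 2) ^ (1 - (b + 2) * Q) * circlePowerIntegral b Q ((starRingEnd ℂ) a) z := by
  have hr : 0 < 1 - ‖z‖ ^ 2 := by nlinarith [norm_nonneg z]
  have hc : ContinuousOn (fun ζ : ℂ => |(a * (ζ / (ζ - z) ^ (b + 2))).re| ^ Q) (sphere 0 1) :=
    (Complex.continuous_re.comp_continuousOn
      (continuousOn_const.mul (continuousOn_kernel hz b))).abs.rpow_const
      fun _ _ => Or.inr (by linarith)
  -- The kernel contributes `‖w + z‖^(2Q) / (1 - ‖z‖²)^((b+2)Q)` and the Jacobian `(1 - ‖z‖²)/‖w +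
  -- z‖²`.
  rw [integral_circleMap_moebius hz hc, circlePowerIntegral,
    ← intervalIntegral.integral_const_mul]
  refine intervalIntegral.integral_congr fun t _ => ?_
  have hw : ‖circleMap 0 1 t‖ = 1 := by simp
  generalize circleMap 0 1 t = w at hw
  have hs := norm_add_pos hw hz
  rw [kernel_moebius hw hz, mul_left_comm, Complex.re_ofReal_mul]
  have e : (a * (starRingEnd ℂ) (w * (w + z) ^ b)).re =
      ((starRingEnd ℂ) a * w * (w + z) ^ b).re := by
    rw [← Complex.conj_re, map_mul, Complex.conj_conj, mul_assoc]
  rw [e]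
  generalize 1 - ‖z‖ ^ 2 = ρ at hr
  rw [abs_mul, abs_of_nonneg (by positivity), Real.mul_rpow (by positivity) (abs_nonneg _),
    Real.div_rpow (by positivity) (by positivity), ← Real.rpow_natCast, ← Real.rpow_natCast,
    ← Real.rpow_mul hs.le,
    ← Real.rpow_mul hr.le, Real.rpow_sub hr, Real.rpow_one]
  have e2 : ‖w + z‖ ^ (2 * (Q - 1)) =
      ‖w + z‖ ^ (((2 : ℕ) : ℝ) * Q) / ‖w + z‖ ^ (((2 : ℕ) : ℝ)) := by
    rw [← Real.rpow_sub hs]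
    congr 1
    push_cast
    ring
  rw [e2]
  push_cast
  ring

end Moebius

/-! ### Derivatives as circle integrals of the real part. -/

section Representation

theorem circleIntegrable_kernel_mul {R : ℝ} {g : ℂ → ℂ} (hg : CircleIntegrable g 0 R) (k : ℕ)
    {z : ℂ} (hz : z ∈ ball (0 : ℂ) R) :
    CircleIntegrable (fun ζ => ζ / (ζ - z) ^ k * g ζ) 0 R := by
  have hc : ContinuousOn (fun ζ : ℂ => ζ / (ζ - z) ^ k) (sphere 0 |R|) := by
    refine continuousOn_id.div (by fun_prop) fun ζ hζ => pow_ne_zero _ ?_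
    rw [mem_sphere_zero_iff_norm, abs_of_pos (pos_of_mem_ball hz)] at hζ
    rw [sub_ne_zero]
    rintro rfl
    exact (mem_ball_zero_iff.1 hz).ne hζ
  exact hg.continuousOn_smul hc

theorem hasDerivAt_circleAverage_kernel {R : ℝ} {g : ℂ → ℂ} (hg : CircleIntegrable g 0 R) (k : ℕ)
    {z : ℂ} (hz : z ∈ ball (0 : ℂ) R) :
    HasDerivAt (fun x => Real.circleAverage (fun ζ => ζ / (ζ - x) ^ (k + 1) * g ζ) 0 R)
      ((k + 1) * Real.circleAverage (fun ζ => ζ / (ζ - z) ^ (k + 2) * g ζ) 0 R) z := by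
  have hR : 0 < R := pos_of_mem_ball hz
  have hzR : ‖z‖ < R := mem_ball_zero_iff.1 hz
  -- Points within `d` of `z` stay at distance at least `d` from the circle, giving a uniform bound
  -- for the differentiated kernel.
  set d := (R - ‖z‖) / 2 with hd
  have hd0 : 0 < d := by rw [hd]; linarith
  have hdist : ∀ x ∈ ball z d, ∀ θ : ℝ, d ≤ ‖circleMap 0 R θ - x‖ := by
    intro x hx θ
    rw [mem_ball, dist_eq_norm] at hx
    have h1 := norm_sub_norm_le (circleMap 0 R θ) x
    have h2 := norm_le_norm_add_norm_sub' x z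
    rw [norm_circleMap_zero, abs_of_pos hR] at h1
    linarith
  have hgm : AEStronglyMeasurable (fun θ => g (circleMap 0 R θ))
      (volume.restrict (uIoc 0 (2 * Real.pi))) := (intervalIntegrable_iff.1 hg).aestronglyMeasurable
  have hmain := (intervalIntegral.hasDerivAt_integral_of_dominated_loc_of_deriv_le
    (F := fun x θ => circleMap 0 R θ / (circleMap 0 R θ - x) ^ (k + 1) * g (circleMap 0 R θ))
    (F' := fun x θ => (k + 1) * (circleMap 0 R θ / (circleMap 0 R θ - x) ^ (k + 2) *
      g (circleMap 0 R θ)))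
    (bound := fun θ => (k + 1) * (R / d ^ (k + 2)) * ‖g (circleMap 0 R θ)‖)
    (a := 0) (b := 2 * Real.pi) (μ := volume)
    (ball_mem_nhds z hd0) ?meas1 ?int ?meas2 ?bound ?int_bound ?diff).2
  case meas1 =>
    filter_upwards with x
    exact (Measurable.aestronglyMeasurable (by fun_prop)).mul hgm
  case int =>
    have h₁ := circleIntegrable_kernel_mul hg (k + 1) hz
    exact h₁
  case meas2 =>
    exact ((Measurable.aestronglyMeasurable (by fun_prop)).mul hgm).const_mul _
  case bound =>
    filter_upwards with θ _ x hx
    rw [norm_mul, norm_mul, norm_div, norm_pow, norm_circleMap_zero, abs_of_pos hR, ← mul_assoc]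
    have : ‖(k + 1 : ℂ)‖ = k + 1 := by
      rw [← Nat.cast_one, ← Nat.cast_add, Complex.norm_natCast]
      push_cast
      rfl
    rw [this]
    gcongr
    exact hdist x hx θ
  case int_bound =>
    exact (IntervalIntegrable.norm hg).const_mul _
  case diff =>
    filter_upwards with θ _ x hx
    have h₁ : circleMap 0 R θ - x ≠ 0 := by
      have := hdist x hx θ
      exact norm_pos_iff.1 (hd0.trans_le this)
    have h₂ := ((((hasDerivAt_id' x).const_sub (circleMap 0 R θ)).fun_pow (k + 1)).fun_inv
      (pow_ne_zero _ h₁)).const_mul (circleMap 0 R θ)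
    have h₃ := h₂.mul_const (g (circleMap 0 R θ))
    simp only [← div_eq_mul_inv] at h₃
    refine h₃.congr_deriv ?_
    have : (circleMap 0 R θ - x) ^ (k + 1) ≠ 0 := pow_ne_zero _ h₁
    simp only [Nat.add_sub_cancel]
    push_cast
    field_simp
    ring
  have h := hmain.const_smul (2 * Real.pi)⁻¹
  rw [intervalIntegral.integral_const_mul] at h
  refine h.congr_deriv ?_
  rw [Real.circleAverage_def]
  simp only [Complex.real_smul]
  ring

/-- The Herglotz integral of a boundary function. -/
noncomputable def herglotz (R : ℝ) (g : ℂ → ℂ) (z : ℂ) : ℂ :=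
  Real.circleAverage (fun ζ => herglotzRieszKernel 0 z ζ • g ζ) 0 R

/-- The factor `2` comes from `∂_z ((ζ + z)/(ζ - z)) = 2ζ/(ζ - z)²`; the factorial comes from the
remaining derivatives. -/
theorem iteratedDeriv_herglotz {R : ℝ} {g : ℂ → ℂ} (hg : CircleIntegrable g 0 R) (k : ℕ)
    {z : ℂ} (hz : z ∈ ball (0 : ℂ) R) :
    iteratedDeriv (k + 1) (herglotz R g) z =
      2 * (k + 1).factorial * Real.circleAverage (fun ζ => ζ / (ζ - z) ^ (k + 2) * g ζ) 0 R := by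
  induction k generalizing z with
  | zero =>
    rw [zero_add, iteratedDeriv_one]
    have := (hasDerivAt_circleAverage_herglotzRieszKernel_smul hg hz).deriv
    rw [show deriv (herglotz R g) z = _ from this, Nat.factorial_one, Nat.cast_one, mul_one,
      ← smul_eq_mul (2 : ℂ), ← Real.circleAverage_fun_smul]
    congr 1
    ext ζ
    simp only [smul_eq_mul]
    ring
  | succ k ih =>
    rw [iteratedDeriv_succ]
    have he : iteratedDeriv (k + 1) (herglotz R g) =ᶠ[𝓝 z] fun x =>
        2 * (k + 1).factorial *
          Real.circleAverage (fun ζ => ζ / (ζ - x) ^ (k + 1 + 1) * g ζ) 0 R := by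
      filter_upwards [isOpen_ball.mem_nhds hz] with x hx using ih hx
    rw [he.deriv_eq, ((hasDerivAt_circleAverage_kernel hg (k + 1) hz).const_mul _).deriv,
      Nat.factorial_succ (k + 1)]
    push_cast
    ring

theorem circleIntegrable_ofReal {g : ℂ → ℝ} {c : ℂ} {R : ℝ} (hg : CircleIntegrable g c R) :
    CircleIntegrable (fun ζ => (g ζ : ℂ)) c R := by
  simp only [CircleIntegrable, intervalIntegrable_iff] at hg ⊢
  exact Complex.ofRealCLM.integrable_comp hg

theorem re_herglotz {R : ℝ} {g : ℂ → ℝ} (hg : CircleIntegrable g 0 R) {z : ℂ}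
    (hz : z ∈ ball (0 : ℂ) R) :
    (herglotz R (fun ζ => (g ζ : ℂ)) z).re =
      Real.circleAverage (fun ζ => poissonKernel 0 z ζ * g ζ) 0 R := by
  rw [herglotz, re_circleAverage_herglotzRieszKernel_smul hg hz,
    ← poissonKernel_eq_re_herglotzRieszKernel]
  rfl

/-- The derivatives of an analytic function in terms of its real part on a circle. -/
theorem iteratedDeriv_eq_circleAverage_re {f : ℂ → ℂ} {R : ℝ}
    (hf : AnalyticOnNhd ℂ f (closedBall 0 R)) (k : ℕ) {z : ℂ} (hz : z ∈ ball (0 : ℂ) R) :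
    iteratedDeriv (k + 1) f z = 2 * (k + 1).factorial *
      Real.circleAverage (fun ζ => ζ / (ζ - z) ^ (k + 2) * ((f ζ).re : ℂ)) 0 R := by
  have hR : 0 < R := pos_of_mem_ball hz
  have hfs : ContinuousOn f (sphere 0 |R|) :=
    hf.continuousOn.mono (by rw [abs_of_pos hR]; exact sphere_subset_closedBall)
  have hgi : CircleIntegrable (fun ζ => (f ζ).re) 0 R :=
    (Complex.continuous_re.comp_continuousOn hfs).circleIntegrable'
  have hgi' := circleIntegrable_ofReal hgi
  rw [← iteratedDeriv_herglotz hgi' k hz]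
  -- By Poisson's formula `f` and the Herglotz integral of `Re f` have equal real parts, so they
  -- differ by a constant, which a derivative of order `k + 1` kills.
  have hre : ∀ w ∈ ball (0 : ℂ) R, (herglotz R (fun ζ => ((f ζ).re : ℂ)) w - f w).re = 0 := by
    intro w hw
    have hdc : DiffContOnCl ℂ f (ball 0 R) := by
      apply DifferentiableOn.diffContOnCl
      rw [closure_ball _ hR.ne']
      exact hf.differentiableOn
    have h1 := hdc.circleAverage_poissonKernel_smul hw
    have hci : CircleIntegrable (poissonKernel 0 w • f) 0 R := by
      refine hfs.circleIntegrable'.continuousOn_smul ?_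
      rw [poissonKernel_eq_re_herglotzRieszKernel]
      exact Complex.continuous_re.comp_continuousOn (continuousOn_herglotzRieszKernel_sphere hw)
    have h2 := Complex.reCLM.circleAverage_comp_comm hci
    rw [h1] at h2
    rw [Complex.sub_re, re_herglotz hgi hw, sub_eq_zero]
    rw [Complex.reCLM_apply] at h2
    rw [← h2]
    congr 1
    ext ζ
    simp
  have han : AnalyticOnNhd ℂ (fun w => herglotz R (fun ζ => ((f ζ).re : ℂ)) w - f w) (ball 0 R) :=
    (analyticOnNhd_circleAverage_herglotzRieszKernel_smul hgi').sub (hf.mono ball_subset_closedBall)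
  obtain ⟨c, hc⟩ := han.eq_const_of_re_eq_const hre isOpen_ball
    ⟨⟨0, mem_ball_self hR⟩, (convex_ball 0 R).isPreconnected⟩
  have he : f =ᶠ[𝓝 z] fun w => herglotz R (fun ζ => ((f ζ).re : ℂ)) w - c := by
    filter_upwards [isOpen_ball.mem_nhds hz] with w hw
    rw [← hc w hw]
    ring
  rw [he.iteratedDeriv_eq, iteratedDeriv_succ', iteratedDeriv_succ']
  congr 1
  ext w
  exact deriv_sub_const _

end Representation

/-! ### Hardy norms and the `L^q` norm of the kernel. -/

section Norms

variable {p q : ℝ≥0∞}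

/-- Lebesgue measure on the parameter interval of the circle. -/
noncomputable def arc : Measure ℝ := volume.restrict (Ioc 0 (2 * Real.pi))

instance : IsFiniteMeasure arc := by
  unfold arc
  infer_instance

theorem eLpNorm_circle_le_hpENorm (hp : 1 ≤ p) (u : ℂ → ℝ) {r : ℝ} (hr : r ∈ Ioo (0 : ℝ) 1) :
    eLpNorm (fun t => u (circleMap 0 r t)) p arc ≤ hpENorm p u := by
  by_cases hp' : p = ∞
  · subst hp'
    rw [hpENorm, if_pos rfl, eLpNorm_exponent_top]
    refine eLpNormEssSup_le_of_ae_enorm_bound (Eventually.of_forall fun t => ?_)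
    have : circleMap 0 r t ∈ ball (0 : ℂ) 1 := by
      rw [mem_ball_zero_iff, norm_circleMap_zero, abs_of_pos hr.1]
      exact hr.2
    exact le_iSup₂ (f := fun z (_ : z ∈ ball (0 : ℂ) 1) => ‖u z‖ₑ) _ this
  · rw [hpENorm, if_neg hp', eLpNorm_eq_lintegral_rpow_enorm_toReal (by positivity) hp']
    refine ENNReal.rpow_le_rpow ?_ (by positivity)
    exact le_iSup₂ (f := fun r (_ : r ∈ Ioo (0 : ℝ) 1) =>
      ∫⁻ t in Ioc 0 (2 * Real.pi), ‖u (circleMap 0 r t)‖ₑ ^ p.toReal) r hr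

theorem hpENorm_le_of_eLpNorm_le (hp : 1 ≤ p) (hp' : p ≠ ∞) {u : ℂ → ℝ} {M : ℝ≥0∞}
    (h : ∀ r ∈ Ioo (0 : ℝ) 1, eLpNorm (fun t => u (circleMap 0 r t)) p arc ≤ M) :
    hpENorm p u ≤ M := by
  have hP : 0 < p.toReal := ENNReal.toReal_pos (by positivity) hp'
  rw [hpENorm, if_neg hp', one_div, ENNReal.rpow_inv_le_iff hP]
  refine iSup₂_le fun r hr => ?_
  have := h r hr
  rwa [eLpNorm_eq_lintegral_rpow_enorm_toReal (by positivity) hp', one_div,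
    ENNReal.rpow_inv_le_iff hP] at this

theorem hpENorm_top_le {u : ℂ → ℝ} {M : ℝ≥0∞} (h : ∀ z ∈ ball (0 : ℂ) 1, ‖u z‖ₑ ≤ M) :
    hpENorm ∞ u ≤ M := by
  rw [hpENorm, if_pos rfl]
  exact iSup₂_le h

theorem hpENorm_lt_top_of_bounded (hp : 1 ≤ p) {u : ℂ → ℝ} {B : ℝ}
    (h : ∀ z ∈ ball (0 : ℂ) 1, |u z| ≤ B) : hpENorm p u < ∞ := by
  by_cases hp' : p = ∞
  · subst hp'
    refine (hpENorm_top_le (M := ENNReal.ofReal B) fun z hz => ?_).trans_lt ENNReal.ofReal_lt_top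
    rw [Real.enorm_eq_ofReal_abs]
    exact ENNReal.ofReal_le_ofReal (h z hz)
  · refine (hpENorm_le_of_eLpNorm_le hp hp'
      (M := arc univ ^ p.toReal⁻¹ * ENNReal.ofReal B) fun r hr => ?_).trans_lt ?_
    · refine eLpNorm_le_of_ae_bound (Eventually.of_forall fun t => ?_)
      refine h _ ?_
      rw [mem_ball_zero_iff, norm_circleMap_zero, abs_of_pos hr.1]
      exact hr.2
    · exact ENNReal.mul_lt_top (ENNReal.rpow_lt_top_of_nonneg (by positivity)
        (measure_ne_top _ _)) ENNReal.ofReal_lt_top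

theorem aestronglyMeasurable_circle {u : ℂ → ℝ} (hu : ContinuousOn u (ball 0 1)) {r : ℝ}
    (hr : r ∈ Ioo (0 : ℝ) 1) (μ : Measure ℝ) :
    AEStronglyMeasurable (fun t => u (circleMap 0 r t)) μ := by
  refine (hu.comp_continuous (continuous_circleMap 0 r) fun t => ?_).aestronglyMeasurable
  rw [mem_ball_zero_iff, norm_circleMap_zero, abs_of_pos hr.1]
  exact hr.2

theorem hpENorm_sub_le (hp : 1 ≤ p) {u v : ℂ → ℝ} (hu : ContinuousOn u (ball 0 1))
    (hv : ContinuousOn v (ball 0 1)) :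
    hpENorm p (fun z => u z - v z) ≤ hpENorm p u + hpENorm p v := by
  by_cases hp' : p = ∞
  · subst hp'
    refine hpENorm_top_le fun z hz => enorm_sub_le.trans ?_
    simp only [hpENorm, if_pos]
    exact add_le_add (le_iSup₂ (f := fun z (_ : z ∈ ball (0 : ℂ) 1) => ‖u z‖ₑ) _ hz)
      (le_iSup₂ (f := fun z (_ : z ∈ ball (0 : ℂ) 1) => ‖v z‖ₑ) _ hz)
  · refine hpENorm_le_of_eLpNorm_le hp hp' fun r hr => ?_
    exact (eLpNorm_sub_le (aestronglyMeasurable_circle hu hr _)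
      (aestronglyMeasurable_circle hv hr _) hp).trans
      (add_le_add (eLpNorm_circle_le_hpENorm hp u hr) (eLpNorm_circle_le_hpENorm hp v hr))

theorem exists_polynomial_bound (P : Polynomial ℂ) :
    ∃ B : ℝ, ∀ z ∈ ball (0 : ℂ) 1, |(P.eval z).re| ≤ B := by
  obtain ⟨B, hB⟩ := (isCompact_closedBall (0 : ℂ) 1).exists_bound_of_continuousOn
    P.continuous.continuousOn
  exact ⟨B, fun z hz => (Complex.abs_re_le_norm _).trans (hB z (ball_subset_closedBall hz))⟩

theorem harmonicOnNhd_re {f : ℂ → ℂ} {s : Set ℂ} (hf : AnalyticOnNhd ℂ f s) :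
    InnerProductSpace.HarmonicOnNhd (fun z => (f z).re) s :=
  fun z hz => (hf z hz).harmonicAt_re

theorem analyticOnNhd_polynomial_eval (P : Polynomial ℂ) (s : Set ℂ) :
    AnalyticOnNhd ℂ (fun z => P.eval z) s :=
  fun _ _ => P.differentiable.analyticAt _

theorem MemHp.re_sub_polynomial (hp : 1 ≤ p) {f : ℂ → ℂ} (hf : AnalyticOnNhd ℂ f (ball 0 1))
    (hu : MemHp p fun z => (f z).re) (P : Polynomial ℂ) :
    MemHp p fun z => (f z - P.eval z).re := by
  refine ⟨harmonicOnNhd_re (hf.sub (analyticOnNhd_polynomial_eval P _)), ?_⟩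
  obtain ⟨B, hB⟩ := exists_polynomial_bound P
  simp only [Complex.sub_re]
  refine (hpENorm_sub_le hp (Complex.continuous_re.comp_continuousOn hf.continuousOn)
    (Complex.continuous_re.comp P.continuous).continuousOn).trans_lt ?_
  exact ENNReal.add_lt_top.2 ⟨hu.2, hpENorm_lt_top_of_bounded hp hB⟩

theorem one_le_conjugate (hpq : p⁻¹ + q⁻¹ = 1) : 1 ≤ q := by
  rw [← ENNReal.inv_le_one, ← hpq]
  exact le_add_self

theorem toReal_inv_add_toReal_inv (hpq : p⁻¹ + q⁻¹ = 1) : (p⁻¹).toReal + (q⁻¹).toReal = 1 := by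
  have h1 : p⁻¹ ≠ ∞ := ne_top_of_le_ne_top ENNReal.one_ne_top (hpq ▸ le_self_add)
  have h2 : q⁻¹ ≠ ∞ := ne_top_of_le_ne_top ENNReal.one_ne_top (hpq ▸ le_add_self)
  rw [← ENNReal.toReal_add h1 h2, hpq, ENNReal.toReal_one]

theorem integral_arc {E : Type*} [NormedAddCommGroup E] [NormedSpace ℝ E] (g : ℝ → E) :
    ∫ t, g t ∂arc = ∫ t in (0 : ℝ)..2 * Real.pi, g t := by
  rw [intervalIntegral.integral_of_le (by positivity), arc]

theorem continuous_re_kernel {z : ℂ} (hz : ‖z‖ < 1) (a : ℂ) (b : ℕ) :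
    Continuous fun t : ℝ => (a * (circleMap 0 1 t / (circleMap 0 1 t - z) ^ (b + 2))).re := by
  have := (continuousOn_const (c := a)).mul (continuousOn_kernel hz b)
  exact Complex.continuous_re.comp (this.comp_continuous (continuous_circleMap 0 1)
    fun t => by simp)

/-- Here `|w - z| ≥ 1 - |z| ≥ (1 - |z|²)/2`. For `q = ∞` this elementary estimate already gives the
sharp constant. -/
theorem norm_kernel_le {z w : ℂ} (hz : ‖z‖ < 1) (hw : ‖w‖ = 1) (b : ℕ) :
    ‖w / (w - z) ^ (b + 2)‖ ≤ 2 ^ (b + 2) * ((1 - ‖z‖ ^ 2) ^ (b + 2))⁻¹ := by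
  have h1 : 1 - ‖z‖ ≤ ‖w - z‖ := by
    have := norm_sub_norm_le w z
    rwa [hw] at this
  have h0 : 0 < 1 - ‖z‖ := by linarith
  have h2 : 0 < 1 - ‖z‖ ^ 2 := by nlinarith [norm_nonneg z]
  rw [norm_div, hw, norm_pow, ← one_div_pow, ← div_eq_mul_inv, ← div_pow]
  refine pow_le_pow_left₀ (by positivity) ?_ _
  rw [div_le_div_iff₀ (by linarith) h2]
  nlinarith [norm_nonneg z]

/-- The `L^q` norm of the kernel representing the derivative. -/
theorem eLpNorm_kernel_le (hpq : p⁻¹ + q⁻¹ = 1) {z : ℂ} (hz : ‖z‖ < 1) {a : ℂ} (ha : ‖a‖ = 1)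
    (b : ℕ) :
    eLpNorm (fun t => (a * (circleMap 0 1 t / (circleMap 0 1 t - z) ^ (b + 2))).re) q arc ≤
      ENNReal.ofReal (Real.pi / (b + 1).factorial * sharpConst (b + 1) q *
        (1 - ‖z‖ ^ 2) ^ (-(p⁻¹).toReal - ((b + 1 : ℕ) : ℝ))) := by
  have hq := one_le_conjugate hpq
  have hs := toReal_inv_add_toReal_inv hpq
  have hr : 0 < 1 - ‖z‖ ^ 2 := by nlinarith [norm_nonneg z]
  have hfac : (0 : ℝ) < (b + 1).factorial := by positivity
  by_cases hq' : q = ∞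
  · subst hq'
    rw [ENNReal.inv_top, ENNReal.toReal_zero, add_zero] at hs
    rw [eLpNorm_exponent_top, sharpConst_top, hs]
    refine eLpNormEssSup_le_of_ae_enorm_bound (Eventually.of_forall fun t => ?_)
    rw [Real.enorm_eq_ofReal_abs]
    refine ENNReal.ofReal_le_ofReal ((Complex.abs_re_le_norm _).trans ?_)
    rw [norm_mul, ha, one_mul]
    refine (norm_kernel_le hz (by simp) b).trans (le_of_eq ?_)
    have e1 : (-1 - ((b + 1 : ℕ) : ℝ)) = -((b + 2 : ℕ) : ℝ) := by push_cast; ring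
    rw [e1, Real.rpow_neg hr.le, Real.rpow_natCast]
    field_simp
  · have hQ : 1 ≤ q.toReal := by simpa using ENNReal.toReal_mono hq' hq
    have hc := continuous_re_kernel hz a b
    have hlin : ∫⁻ t, ‖(a * (circleMap 0 1 t / (circleMap 0 1 t - z) ^ (b + 2))).re‖ₑ ^ q.toReal
        ∂arc = ENNReal.ofReal ((1 - ‖z‖ ^ 2) ^ (1 - (b + 2) * q.toReal) *
          circlePowerIntegral b q.toReal ((starRingEnd ℂ) a) z) := by
      rw [← integral_abs_re_kernel_rpow hz hQ, ← integral_arc,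
        ofReal_integral_eq_lintegral_ofReal]
      · refine lintegral_congr fun t => ?_
        rw [Real.enorm_eq_ofReal_abs, ENNReal.ofReal_rpow_of_nonneg (abs_nonneg _) (by linarith)]
      · exact ((hc.abs.rpow_const fun _ => Or.inr (by linarith)).integrableOn_Icc).mono_set
          Ioc_subset_Icc_self
      · exact Eventually.of_forall fun t => by positivity
    rw [eLpNorm_eq_lintegral_rpow_enorm_toReal (by positivity) hq', hlin,
      ENNReal.ofReal_rpow_of_nonneg (mul_nonneg (by positivity) (circlePowerIntegral_nonneg _ _))
        (by positivity)]
    refine ENNReal.ofReal_le_ofReal ?_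
    rw [Real.mul_rpow (by positivity) (circlePowerIntegral_nonneg _ _), ← Real.rpow_mul hr.le]
    -- Indeed `1/q - (b + 2) = -1/p - (b + 1)`.
    have e1 : (1 - (b + 2) * q.toReal) * (1 / q.toReal) = -(p⁻¹).toReal - ((b + 1 : ℕ) : ℝ) := by
      rw [ENNReal.toReal_inv q] at hs
      have : (p⁻¹).toReal = 1 - (q.toReal)⁻¹ := by linarith
      rw [this]
      push_cast
      field_simp
      ring
    rw [e1, mul_comm]
    have h := circlePowerIntegral_rpow_le hq hq' b (c := (starRingEnd ℂ) a) (by simpa) hz.le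
    gcongr
    rw [div_mul_eq_mul_div, le_div_iff₀ hfac]
    rw [div_mul_eq_mul_div, div_le_iff₀ Real.pi_pos] at h
    linarith

theorem sharpConst_nonneg (hq : 1 ≤ q) (b : ℕ) : 0 ≤ sharpConst (b + 1) q := by
  by_cases hq' : q = ∞
  · subst hq'
    rw [sharpConst_top]
    positivity
  · refine le_trans ?_ (circlePowerIntegral_rpow_le hq hq' b (c := 1) (z := 0) (by simp) (by simp))
    have := circlePowerIntegral_nonneg (b := b) (Q := q.toReal) 1 0
    positivity

end Norms

/-! ### The upper bound by Hölder's inequality. -/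

section UpperBound

variable {p q : ℝ≥0∞}

theorem exists_norm_one_mul_eq_norm (D : ℂ) : ∃ a : ℂ, ‖a‖ = 1 ∧ (a * D).re = ‖D‖ := by
  by_cases hD : D = 0
  · exact ⟨1, by simp, by simp [hD]⟩
  · have hn : (‖D‖ : ℂ) ≠ 0 := by simpa using hD
    refine ⟨(starRingEnd ℂ) D / ‖D‖, by simp [hD], ?_⟩
    have : (starRingEnd ℂ) D / ‖D‖ * D = (‖D‖ : ℂ) := by
      rw [div_mul_eq_mul_div, mul_comm, Complex.mul_conj, Complex.normSq_eq_norm_sq]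
      push_cast
      field_simp
    rw [this, Complex.ofReal_re]

/-- The kernel representation of the derivative on the circle of radius `R`, rescaled to the unit
circle. -/
theorem re_iteratedDeriv_eq_integral {f : ℂ → ℂ} {R : ℝ} (hf : AnalyticOnNhd ℂ f (closedBall 0 R))
    (b : ℕ) {z : ℂ} (hz : z ∈ ball (0 : ℂ) R) (a : ℂ) :
    (a * iteratedDeriv (b + 1) f z).re = (b + 1).factorial / Real.pi * (R ^ (b + 1))⁻¹ *
      ∫ t, (a * (circleMap 0 1 t / (circleMap 0 1 t - z / R) ^ (b + 2))).re *
        (f (circleMap 0 R t)).re ∂arc := by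
  have hR : 0 < R := pos_of_mem_ball hz
  have hRc : (R : ℂ) ≠ 0 := by exact_mod_cast hR.ne'
  have hz1 : ‖z / R‖ < 1 := by
    rw [norm_div, Complex.norm_real, Real.norm_of_nonneg hR.le, div_lt_one hR]
    exact mem_ball_zero_iff.1 hz
  have hw : ∀ t, circleMap 0 R t = R * circleMap 0 1 t := by
    intro t
    simp [circleMap]
  have hcont : Continuous fun t : ℝ => a * (circleMap 0 1 t / (circleMap 0 1 t - z / R) ^ (b + 2) *
      ((f (circleMap 0 R t)).re : ℂ)) := by
    refine continuous_const.mul (((continuousOn_kernel hz1 b).comp_continuous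
      (continuous_circleMap 0 1) fun t => by simp).mul (Complex.continuous_ofReal.comp
      (Complex.continuous_re.comp (hf.continuousOn.comp_continuous (continuous_circleMap 0 R)
        fun t => ?_))))
    rw [mem_closedBall_zero_iff, norm_circleMap_zero, abs_of_pos hR]
  have hint : Integrable (fun t : ℝ => a * (circleMap 0 1 t /
      (circleMap 0 1 t - z / R) ^ (b + 2) * ((f (circleMap 0 R t)).re : ℂ))) arc :=
    hcont.integrableOn_Icc.mono_set Ioc_subset_Icc_self
  have h1 : a * iteratedDeriv (b + 1) f z =
      ((((b + 1).factorial / Real.pi * (R ^ (b + 1))⁻¹ : ℝ)) : ℂ) *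
        ∫ t, a * (circleMap 0 1 t / (circleMap 0 1 t - z / R) ^ (b + 2) *
          ((f (circleMap 0 R t)).re : ℂ)) ∂arc := by
    rw [iteratedDeriv_eq_circleAverage_re hf b hz, Real.circleAverage_def, Complex.real_smul,
      ← integral_arc]
    have e : ∀ t, circleMap 0 R t / (circleMap 0 R t - z) ^ (b + 2) *
        ((f (circleMap 0 R t)).re : ℂ) = ((R : ℂ) ^ (b + 1))⁻¹ *
        (circleMap 0 1 t / (circleMap 0 1 t - z / R) ^ (b + 2) *
          ((f (circleMap 0 R t)).re : ℂ)) := by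
      intro t
      rw [← mul_assoc]
      congr 1
      have h2 : circleMap 0 R t - z = R * (circleMap 0 1 t - z / R) := by
        rw [hw, mul_sub, mul_div_cancel₀ _ hRc]
      rw [h2, hw, mul_pow, pow_succ (R : ℂ) (b + 1), inv_mul_eq_div, div_div,
        mul_comm ((R : ℂ) ^ (b + 1)), mul_assoc, mul_div_mul_left _ _ hRc,
        mul_comm ((R : ℂ) ^ (b + 1))]
    simp only [e]
    rw [integral_const_mul, integral_const_mul]
    push_cast
    have hpi : (Real.pi : ℂ) ≠ 0 := by exact_mod_cast Real.pi_ne_zero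
    generalize ∫ t, circleMap 0 1 t / (circleMap 0 1 t - z / R) ^ (b + 2) *
          ((f (circleMap 0 R t)).re : ℂ) ∂arc = J
    field_simp
  rw [h1, Complex.re_ofReal_mul]
  congr 1
  rw [← Complex.reCLM_apply, ← Complex.reCLM.integral_comp_comm hint]
  refine integral_congr_ae (Eventually.of_forall fun t => ?_)
  simp only [Complex.reCLM_apply]
  rw [← mul_assoc, mul_comm _ (((f _).re : ℝ) : ℂ), Complex.re_ofReal_mul, mul_comm]

theorem abs_integral_mul_le (hpq : p⁻¹ + q⁻¹ = 1) {k u : ℝ → ℝ} (hk : AEStronglyMeasurable k arc)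
    (hu : AEStronglyMeasurable u arc) {A B : ℝ} (hA : 0 ≤ A) (hB : 0 ≤ B)
    (hkA : eLpNorm k q arc ≤ ENNReal.ofReal A) (huB : eLpNorm u p arc ≤ ENNReal.ofReal B) :
    |∫ t, k t * u t ∂arc| ≤ A * B := by
  have : ENNReal.HolderTriple q p 1 := ⟨by rw [add_comm, hpq, inv_one]⟩
  have h1 := eLpNorm_smul_le_mul_eLpNorm (p := q) (q := p) (r := 1) hu hk
  rw [eLpNorm_one_eq_lintegral_enorm] at h1
  have h2 := (enorm_integral_le_lintegral_enorm (μ := arc) (k • u)).trans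
    (h1.trans (mul_le_mul' hkA huB))
  rw [← ENNReal.ofReal_mul hA, Real.enorm_eq_ofReal_abs,
    ENNReal.ofReal_le_ofReal_iff (by positivity)] at h2
  exact h2

/-- Working on a circle of radius `R < 1` avoids boundary values of `Re f`, which need not represent
it when `p = 1`; the limit `R → 1` is taken afterwards. -/
theorem norm_iteratedDeriv_le_of_radius (hp : 1 ≤ p) (hpq : p⁻¹ + q⁻¹ = 1) {f : ℂ → ℂ}
    (hf : AnalyticOnNhd ℂ f (ball 0 1)) (hu : MemHp p fun z => (f z).re) (b : ℕ) {z : ℂ} {R : ℝ}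
    (hzR : ‖z‖ < R) (hR1 : R < 1) :
    ‖iteratedDeriv (b + 1) f z‖ ≤ (R ^ (b + 1))⁻¹ * (sharpConst (b + 1) q *
      (1 - (‖z‖ / R) ^ 2) ^ (-(p⁻¹).toReal - ((b + 1 : ℕ) : ℝ)) *
        hpNorm p (fun w => (f w).re)) := by
  have hR : 0 < R := (norm_nonneg z).trans_lt hzR
  have hz : z ∈ ball (0 : ℂ) R := mem_ball_zero_iff.2 hzR
  have hz1n : ‖z / R‖ = ‖z‖ / R := by
    rw [norm_div, Complex.norm_real, Real.norm_of_nonneg hR.le]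
  have hz1 : ‖z / R‖ < 1 := by rwa [hz1n, div_lt_one hR]
  -- Rotating the derivative to a positive real lets the real part pass onto the kernel, since `Re
  -- f` is real.
  obtain ⟨a, ha, haD⟩ := exists_norm_one_mul_eq_norm (iteratedDeriv (b + 1) f z)
  rw [← haD, re_iteratedDeriv_eq_integral
    (hf.mono (closedBall_subset_ball hR1)) b hz a]
  have hC := sharpConst_nonneg (one_le_conjugate hpq) b
  have hr : 0 < 1 - ‖z / R‖ ^ 2 := by nlinarith [norm_nonneg (z / R)]
  have hB : eLpNorm (fun t => (f (circleMap 0 R t)).re) p arc ≤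
      ENNReal.ofReal (hpNorm p (fun w => (f w).re)) := by
    rw [hpNorm, ENNReal.ofReal_toReal hu.2.ne]
    exact eLpNorm_circle_le_hpENorm hp (fun w => (f w).re) ⟨hR, hR1⟩
  have hmain := abs_integral_mul_le hpq
    (continuous_re_kernel hz1 a b).aestronglyMeasurable
    (aestronglyMeasurable_circle (Complex.continuous_re.comp_continuousOn hf.continuousOn)
      ⟨hR, hR1⟩ _) (by positivity) ENNReal.toReal_nonneg (eLpNorm_kernel_le hpq hz1 ha b) hB
  refine (mul_le_mul_of_nonneg_left ((le_abs_self _).trans hmain) (by positivity)).trans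
    (le_of_eq ?_)
  rw [hz1n, ← hpNorm]
  field_simp

theorem norm_iteratedDeriv_le (hp : 1 ≤ p) (hpq : p⁻¹ + q⁻¹ = 1) {f : ℂ → ℂ}
    (hf : AnalyticOnNhd ℂ f (ball 0 1)) (hu : MemHp p fun z => (f z).re) (b : ℕ) {z : ℂ}
    (hz : z ∈ ball (0 : ℂ) 1) :
    ‖iteratedDeriv (b + 1) f z‖ ≤ sharpConst (b + 1) q *
      (1 - ‖z‖ ^ 2) ^ (-(p⁻¹).toReal - ((b + 1 : ℕ) : ℝ)) * hpNorm p (fun w => (f w).re) := by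
  rw [mem_ball_zero_iff] at hz
  have hr : 0 < 1 - ‖z‖ ^ 2 := by nlinarith [norm_nonneg z]
  have hc : ContinuousAt (fun R : ℝ => (R ^ (b + 1))⁻¹ * (sharpConst (b + 1) q *
      (1 - (‖z‖ / R) ^ 2) ^ (-(p⁻¹).toReal - ((b + 1 : ℕ) : ℝ)) *
        hpNorm p (fun w => (f w).re))) 1 := by
    have h1 : ContinuousAt (fun R : ℝ => 1 - (‖z‖ / R) ^ 2) 1 := by
      refine continuousAt_const.sub ((continuousAt_const.div continuousAt_id one_ne_zero).pow 2)
    have h2 : ContinuousAt (fun R : ℝ =>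
        (1 - (‖z‖ / R) ^ 2) ^ (-(p⁻¹).toReal - ((b + 1 : ℕ) : ℝ))) 1 :=
      h1.rpow_const (Or.inl (by simpa using hr.ne'))
    exact ((continuousAt_id.pow _).inv₀ (by simp)).mul
      ((continuousAt_const.mul h2).mul continuousAt_const)
  have ht := hc.tendsto.mono_left (nhdsWithin_le_nhds (s := Iio 1))
  rw [one_pow, inv_one, one_mul, div_one] at ht
  refine ge_of_tendsto ht ?_
  filter_upwards [Ioo_mem_nhdsLT hz] with R hR
  exact norm_iteratedDeriv_le_of_radius hp hpq hf hu b hR.1 hR.2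

/-- Subtracting a polynomial of degree at most `b` does not change the derivative of order
`b + 1`. -/
theorem iteratedDeriv_sub_polynomial {f : ℂ → ℂ} {z : ℂ} (hf : AnalyticAt ℂ f z)
    {P : Polynomial ℂ} {b : ℕ} (hP : P.natDegree ≤ b) :
    iteratedDeriv (b + 1) (fun w => f w - P.eval w) z = iteratedDeriv (b + 1) f z := by
  have h0 : iteratedDeriv (b + 1) (fun w => P.eval w) = 0 := by
    rw [iteratedDeriv_eq_iterate]
    have : ∀ (m : ℕ) (P : Polynomial ℂ), deriv^[m] (fun w => P.eval w) =
        fun w => (Polynomial.derivative^[m] P).eval w := by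
      intro m
      induction m with
      | zero => intro P; rfl
      | succ m ih =>
        intro P
        rw [Function.iterate_succ_apply, Function.iterate_succ_apply]
        have : deriv (fun w => P.eval w) = fun w => P.derivative.eval w := by
          ext w
          exact P.deriv
        rw [this, ih]
    rw [this, Polynomial.iterate_derivative_eq_zero (by omega)]
    ext w
    simp
  rw [iteratedDeriv_fun_sub hf.contDiffAt (P.differentiable.analyticAt z).contDiffAt, h0]
  simp

end UpperBound

/-! ### Poisson integrals as contractions into `h^p`. -/

section Poisson

variable {p q : ℝ≥0∞}

theorem poissonKernel_zero_circleMap (z : ℂ) (t : ℝ) :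
    poissonKernel 0 z (circleMap 0 1 t) = (1 - ‖z‖ ^ 2) / ‖circleMap 0 1 t - z‖ ^ 2 := by
  simp [poissonKernel]

/-- The Poisson kernel at `z` is the Jacobian of the Möbius substitution with parameter `-z`, so its
mass is the length of the circle. -/
theorem integral_poissonKernel {z : ℂ} (hz : ‖z‖ < 1) :
    ∫ t, poissonKernel 0 z (circleMap 0 1 t) ∂arc = 2 * Real.pi := by
  have h := integral_circleMap_moebius (z := -z) (by rwa [norm_neg]) (g := fun _ => 1)
    continuousOn_const
  rw [integral_arc]
  simp only [one_mul, norm_neg, ← sub_eq_add_neg] at h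
  simp only [poissonKernel_zero_circleMap]
  rw [← h]
  simp

theorem norm_circleMap_zero_lt_one {r : ℝ} (hr : r ∈ Ioo (0 : ℝ) 1) (t : ℝ) :
    ‖circleMap 0 r t‖ < 1 := by
  rw [norm_circleMap_zero, abs_of_pos hr.1]
  exact hr.2

/-- After Tonelli the integration is over the angle of the interior point; this symmetry turns it
into integration over the boundary, where the mass is known. -/
theorem poissonKernel_circleMap_symm (r s t : ℝ) :
    poissonKernel 0 (circleMap 0 r t) (circleMap 0 1 s) =
      poissonKernel 0 (circleMap 0 r s) (circleMap 0 1 t) := by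
  simp only [poissonKernel_zero_circleMap, norm_circleMap_zero]
  congr 2
  have h : circleMap 0 1 s - circleMap 0 r t = circleMap 0 1 s * circleMap 0 1 t *
      (starRingEnd ℂ) (circleMap 0 1 t - circleMap 0 r s) := by
    have h1 : ∀ x, circleMap 0 1 x * (starRingEnd ℂ) (circleMap 0 1 x) = 1 := by
      intro x
      rw [Complex.mul_conj, Complex.normSq_eq_norm_sq, norm_circleMap_zero]
      simp
    have h2 : ∀ x, circleMap 0 r x = r * circleMap 0 1 x := fun x => by simp [circleMap]
    simp only [h2, map_sub, map_mul, Complex.conj_ofReal]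
    linear_combination (-circleMap 0 1 s) * h1 t + r * circleMap 0 1 t * h1 s
  rw [h, norm_mul, norm_mul, Complex.norm_conj]
  simp

theorem poissonKernel_circleMap_nonneg {z : ℂ} (hz : ‖z‖ < 1) (t : ℝ) :
    0 ≤ poissonKernel 0 z (circleMap 0 1 t) := by
  rw [poissonKernel_zero_circleMap]
  have : 0 ≤ 1 - ‖z‖ ^ 2 := by nlinarith [norm_nonneg z]
  positivity

theorem continuous_poissonKernel_circleMap {r : ℝ} (hr : r ∈ Ioo (0 : ℝ) 1) :
    Continuous fun x : ℝ × ℝ => poissonKernel 0 (circleMap 0 r x.1) (circleMap 0 1 x.2) := by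
  simp only [poissonKernel_zero_circleMap]
  refine Continuous.div (by fun_prop) (by fun_prop) fun x => ?_
  have h1 := norm_sub_norm_le (circleMap 0 1 x.2) (circleMap 0 r x.1)
  have h2 := norm_circleMap_zero_lt_one hr x.1
  have h3 : ‖circleMap 0 1 x.2‖ = 1 := by simp
  have : 0 < ‖circleMap 0 1 x.2 - circleMap 0 r x.1‖ := by linarith
  positivity

theorem lintegral_poissonKernel {z : ℂ} (hz : ‖z‖ < 1) :
    ∫⁻ t, ENNReal.ofReal ((2 * Real.pi)⁻¹ * poissonKernel 0 z (circleMap 0 1 t)) ∂arc = 1 := by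
  have hi : Integrable (fun t => poissonKernel 0 z (circleMap 0 1 t)) arc := by
    refine Integrable.of_integral_ne_zero ?_
    rw [integral_poissonKernel hz]
    positivity
  rw [← ofReal_integral_eq_lintegral_ofReal (hi.const_mul _), integral_const_mul,
    integral_poissonKernel hz, inv_mul_cancel₀ (by positivity), ENNReal.ofReal_one]
  exact Eventually.of_forall fun t =>
    mul_nonneg (by positivity) (poissonKernel_circleMap_nonneg hz t)

theorem enorm_re_herglotz_le {g : ℂ → ℝ} (hgi : CircleIntegrable g 0 1) {z : ℂ} (hz : ‖z‖ < 1) :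
    ‖(herglotz 1 (fun ζ => (g ζ : ℂ)) z).re‖ₑ ≤
      ∫⁻ s, ENNReal.ofReal ((2 * Real.pi)⁻¹ * poissonKernel 0 z (circleMap 0 1 s)) *
        ‖g (circleMap 0 1 s)‖ₑ ∂arc := by
  rw [re_herglotz hgi (mem_ball_zero_iff.2 hz), Real.circleAverage_def, smul_eq_mul, ← integral_arc,
    ← integral_const_mul]
  refine (enorm_integral_le_lintegral_enorm _).trans (le_of_eq (lintegral_congr fun s => ?_))
  rw [← mul_assoc, enorm_mul, Real.enorm_of_nonneg
    (mul_nonneg (by positivity) (poissonKernel_circleMap_nonneg hz s))]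

/-- Jensen's inequality for the Poisson kernel. -/
theorem lintegral_poissonKernel_mul_rpow_le {g : ℂ → ℝ} (hg : Measurable g) {P : ℝ} (hP : 1 ≤ P)
    {z : ℂ} (hz : ‖z‖ < 1) :
    (∫⁻ s, ENNReal.ofReal ((2 * Real.pi)⁻¹ * poissonKernel 0 z (circleMap 0 1 s)) *
        ‖g (circleMap 0 1 s)‖ₑ ∂arc) ^ P ≤
      ∫⁻ s, ENNReal.ofReal ((2 * Real.pi)⁻¹ * poissonKernel 0 z (circleMap 0 1 s)) *
        ‖g (circleMap 0 1 s)‖ₑ ^ P ∂arc := by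
  have hcm : Measurable fun s => circleMap 0 1 s := measurable_circleMap 0 1
  have hK : Measurable fun s : ℝ =>
      ENNReal.ofReal ((2 * Real.pi)⁻¹ * poissonKernel 0 z (circleMap 0 1 s)) := by
    simp only [poissonKernel_zero_circleMap]
    fun_prop
  have hgm : Measurable fun s => ‖g (circleMap 0 1 s)‖ₑ := (hg.comp hcm).enorm
  set ν := arc.withDensity fun s =>
    ENNReal.ofReal ((2 * Real.pi)⁻¹ * poissonKernel 0 z (circleMap 0 1 s)) with hν
  have hprob : IsProbabilityMeasure ν := ⟨by
    rw [hν, withDensity_apply _ MeasurableSet.univ, Measure.restrict_univ,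
      lintegral_poissonKernel hz]⟩
  -- The normalized Poisson kernel is a probability density, and `L^P` norms increase with the
  -- exponent on a probability space.
  have h1 := eLpNorm_le_eLpNorm_of_exponent_le (μ := ν) (p := 1) (q := ENNReal.ofReal P)
    (f := fun s => g (circleMap 0 1 s)) (by rwa [ENNReal.one_le_ofReal])
    (hg.comp hcm).aestronglyMeasurable
  rw [eLpNorm_one_eq_lintegral_enorm, eLpNorm_eq_lintegral_rpow_enorm_toReal
    (by simp; linarith) ENNReal.ofReal_ne_top, ENNReal.toReal_ofReal (by linarith), one_div,
    ENNReal.le_rpow_inv_iff (by linarith), hν,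
    lintegral_withDensity_eq_lintegral_mul _ hK hgm,
    lintegral_withDensity_eq_lintegral_mul _ hK (hgm.pow_const P)] at h1
  exact h1

/-- The Poisson integral is a contraction from `L^p` of the circle to `h^p`. -/
theorem hpENorm_re_herglotz_le (hp : 1 ≤ p) (hp' : p ≠ ∞) {g : ℂ → ℝ} (hg : Measurable g)
    (hgi : CircleIntegrable g 0 1) :
    hpENorm p (fun z => (herglotz 1 (fun ζ => (g ζ : ℂ)) z).re) ≤
      eLpNorm (fun t => g (circleMap 0 1 t)) p arc := by
  have hP : 1 ≤ p.toReal := by simpa using ENNReal.toReal_mono hp' hp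
  have hP0 : 0 < p.toReal := by linarith
  refine hpENorm_le_of_eLpNorm_le hp hp' fun r hr => ?_
  rw [eLpNorm_eq_lintegral_rpow_enorm_toReal (by positivity) hp',
    eLpNorm_eq_lintegral_rpow_enorm_toReal (by positivity) hp']
  refine ENNReal.rpow_le_rpow ?_ (by positivity)
  calc ∫⁻ t, ‖(herglotz 1 (fun ζ => (g ζ : ℂ)) (circleMap 0 r t)).re‖ₑ ^ p.toReal ∂arc
      ≤ ∫⁻ t, ∫⁻ s, ENNReal.ofReal ((2 * Real.pi)⁻¹ *
          poissonKernel 0 (circleMap 0 r t) (circleMap 0 1 s)) *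
            ‖g (circleMap 0 1 s)‖ₑ ^ p.toReal ∂arc ∂arc := by
        refine lintegral_mono fun t => ?_
        have hz := norm_circleMap_zero_lt_one hr t
        exact (ENNReal.rpow_le_rpow (enorm_re_herglotz_le hgi hz) hP0.le).trans
          (lintegral_poissonKernel_mul_rpow_le hg hP hz)
    _ = ∫⁻ s, ∫⁻ t, ENNReal.ofReal ((2 * Real.pi)⁻¹ *
          poissonKernel 0 (circleMap 0 r t) (circleMap 0 1 s)) *
            ‖g (circleMap 0 1 s)‖ₑ ^ p.toReal ∂arc ∂arc := by
        refine lintegral_lintegral_swap (Measurable.aemeasurable ?_)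
        refine Measurable.mul ?_ ?_
        · exact (continuous_const.mul
            (continuous_poissonKernel_circleMap hr)).measurable.ennreal_ofReal
        · exact ((hg.comp (measurable_circleMap 0 1)).comp measurable_snd).enorm.pow_const _
    _ = ∫⁻ s, ‖g (circleMap 0 1 s)‖ₑ ^ p.toReal ∂arc := by
        refine lintegral_congr fun s => ?_
        have hm : Measurable fun t => ENNReal.ofReal ((2 * Real.pi)⁻¹ *
            poissonKernel 0 (circleMap 0 r t) (circleMap 0 1 s)) :=
          (continuous_const.mul ((continuous_poissonKernel_circleMap hr).comp
            (by fun_prop : Continuous fun t : ℝ => (t, s)))).measurable.ennreal_ofReal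
        rw [lintegral_mul_const _ hm]
        simp only [poissonKernel_circleMap_symm r s]
        rw [lintegral_poissonKernel (norm_circleMap_zero_lt_one hr s), one_mul]

theorem hpENorm_top_re_herglotz_le {g : ℂ → ℝ} (hgi : CircleIntegrable g 0 1)
    (hb : ∀ t, |g (circleMap 0 1 t)| ≤ 1) :
    hpENorm ∞ (fun z => (herglotz 1 (fun ζ => (g ζ : ℂ)) z).re) ≤ 1 := by
  refine hpENorm_top_le fun z hz => ?_
  have hz' := mem_ball_zero_iff.1 hz
  refine (enorm_re_herglotz_le hgi hz').trans ?_
  rw [← lintegral_poissonKernel hz']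
  refine lintegral_mono fun s => mul_le_of_le_one_right (by positivity) ?_
  rw [Real.enorm_eq_ofReal_abs, ← ENNReal.ofReal_one]
  exact ENNReal.ofReal_le_ofReal (hb s)

end Poisson

/-! ### Extremal functions for Hölder's inequality. -/

section Extremal

variable {p q : ℝ≥0∞}

/-- The function `|k| ^ (Q - 1)` with the sign of `k`. -/
noncomputable def signedRpow (Q x : ℝ) : ℝ := if 0 ≤ x then |x| ^ (Q - 1) else -|x| ^ (Q - 1)

theorem abs_signedRpow (Q x : ℝ) : |signedRpow Q x| = |x| ^ (Q - 1) := by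
  unfold signedRpow
  split_ifs
  · exact abs_of_nonneg (by positivity)
  · rw [abs_neg]; exact abs_of_nonneg (by positivity)

theorem mul_signedRpow {Q : ℝ} (hQ : 1 ≤ Q) (x : ℝ) : x * signedRpow Q x = |x| ^ Q := by
  have h : |x| * |x| ^ (Q - 1) = |x| ^ Q := by
    conv_lhs => rw [← Real.rpow_one |x|, ← Real.rpow_mul (abs_nonneg x), one_mul]
    rw [← Real.rpow_add_of_nonneg (abs_nonneg x) zero_le_one (by linarith)]
    congr 1
    ring
  unfold signedRpow
  split_ifs with hx
  · rw [← h, abs_of_nonneg hx]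
  · rw [← h, abs_of_neg (not_le.1 hx)]; ring

theorem measurable_signedRpow (Q : ℝ) : Measurable (signedRpow Q) := by
  unfold signedRpow
  exact Measurable.ite measurableSet_Ici (by fun_prop) (by fun_prop)

theorem eLpNorm_signedRpow (hp : 1 ≤ p) (hp' : p ≠ ∞) {Q : ℝ} (hQ : (Q - 1) * p.toReal = Q)
    {k : ℝ → ℝ} (hk : Integrable (fun t => |k t| ^ Q) arc) :
    eLpNorm (fun t => signedRpow Q (k t)) p arc =
      ENNReal.ofReal ((∫ t, |k t| ^ Q ∂arc) ^ (p⁻¹).toReal) := by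
  have hP : 1 ≤ p.toReal := by simpa using ENNReal.toReal_mono hp' hp
  rw [eLpNorm_eq_lintegral_rpow_enorm_toReal (by positivity) hp', one_div, ENNReal.toReal_inv,
    ← ENNReal.ofReal_rpow_of_nonneg (integral_nonneg fun _ => by positivity) (by positivity),
    ofReal_integral_eq_lintegral_ofReal hk (Eventually.of_forall fun _ => by positivity)]
  congr 1
  refine lintegral_congr fun t => ?_
  rw [Real.enorm_eq_ofReal_abs, abs_signedRpow,
    ENNReal.ofReal_rpow_of_nonneg (by positivity) (by linarith), ← Real.rpow_mul (abs_nonneg _), hQ]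

/-- The kernel representation directly on the unit circle, for boundary data that are merely
integrable: the extremal data may be discontinuous. -/
theorem re_iteratedDeriv_herglotz {g : ℂ → ℝ} (hg : CircleIntegrable g 0 1) (b : ℕ) {z : ℂ}
    (hz : ‖z‖ < 1) (a : ℂ) :
    (a * iteratedDeriv (b + 1) (herglotz 1 fun ζ => (g ζ : ℂ)) z).re =
      (b + 1).factorial / Real.pi *
        ∫ t, (a * (circleMap 0 1 t / (circleMap 0 1 t - z) ^ (b + 2))).re *
          g (circleMap 0 1 t) ∂arc := by
  have hzb : z ∈ ball (0 : ℂ) 1 := mem_ball_zero_iff.2 hz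
  have hint : Integrable (fun t : ℝ => a * (circleMap 0 1 t /
      (circleMap 0 1 t - z) ^ (b + 2) * (g (circleMap 0 1 t) : ℂ))) arc := by
    have := circleIntegrable_kernel_mul (circleIntegrable_ofReal hg) (b + 2) hzb
    rw [CircleIntegrable, intervalIntegrable_iff, uIoc_of_le (by positivity)] at this
    exact this.const_mul a
  have h1 : a * iteratedDeriv (b + 1) (herglotz 1 fun ζ => (g ζ : ℂ)) z =
      ((((b + 1).factorial / Real.pi : ℝ)) : ℂ) *
        ∫ t, a * (circleMap 0 1 t / (circleMap 0 1 t - z) ^ (b + 2) *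
          (g (circleMap 0 1 t) : ℂ)) ∂arc := by
    rw [iteratedDeriv_herglotz (circleIntegrable_ofReal hg) b hzb, Real.circleAverage_def,
      Complex.real_smul, ← integral_arc, integral_const_mul]
    push_cast
    have hpi : (Real.pi : ℂ) ≠ 0 := by exact_mod_cast Real.pi_ne_zero
    generalize ∫ t, circleMap 0 1 t / (circleMap 0 1 t - z) ^ (b + 2) *
          (g (circleMap 0 1 t) : ℂ) ∂arc = J
    field_simp
  rw [h1, Complex.re_ofReal_mul]
  congr 1
  rw [← Complex.reCLM_apply, ← Complex.reCLM.integral_comp_comm hint]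
  refine integral_congr_ae (Eventually.of_forall fun t => ?_)
  simp only [Complex.reCLM_apply]
  rw [← mul_assoc, mul_comm _ ((g _ : ℝ) : ℂ), Complex.re_ofReal_mul, mul_comm]

/-- The dual extremal function of the kernel: an analytic function for which Hölder's inequality
is an equality. -/
theorem exists_extremal (hp : 1 ≤ p) (hpq : p⁻¹ + q⁻¹ = 1) (hq' : q ≠ ∞) (b : ℕ) {z : ℂ}
    (hz : ‖z‖ < 1) {a : ℂ} (ha : ‖a‖ = 1) :
    ∃ f : ℂ → ℂ, AnalyticOnNhd ℂ f (ball 0 1) ∧ MemHp p (fun z => (f z).re) ∧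
      hpNorm p (fun z => (f z).re) ≤ ((1 - ‖z‖ ^ 2) ^ (1 - (b + 2) * q.toReal) *
        circlePowerIntegral b q.toReal ((starRingEnd ℂ) a) z) ^ (p⁻¹).toReal ∧
      (b + 1).factorial / Real.pi * ((1 - ‖z‖ ^ 2) ^ (1 - (b + 2) * q.toReal) *
        circlePowerIntegral b q.toReal ((starRingEnd ℂ) a) z) ≤ ‖iteratedDeriv (b + 1) f z‖ := by
  have hq := one_le_conjugate hpq
  have hQ : 1 ≤ q.toReal := by simpa using ENNReal.toReal_mono hq' hq
  set Q := q.toReal with hQd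
  have hs := toReal_inv_add_toReal_inv hpq
  set k : ℂ → ℝ := fun ζ => (a * (ζ / (ζ - z) ^ (b + 2))).re with hk
  set g : ℂ → ℝ := fun ζ => signedRpow Q (k ζ) with hg
  have hkm : Measurable k := by
    rw [hk]
    fun_prop
  have hgm : Measurable g := (measurable_signedRpow Q).comp hkm
  have hkc : Continuous fun t => k (circleMap 0 1 t) := continuous_re_kernel hz a b
  have hkQ : Integrable (fun t => |k (circleMap 0 1 t)| ^ Q) arc :=
    (hkc.abs.rpow_const fun _ => Or.inr (by linarith)).integrableOn_Icc.mono_set Ioc_subset_Icc_self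
  have hgi : CircleIntegrable g 0 1 := by
    have hi : IntervalIntegrable (fun t => |k (circleMap 0 1 t)| ^ (Q - 1)) volume 0
        (2 * Real.pi) :=
      (hkc.abs.rpow_const fun _ => Or.inr (by linarith)).intervalIntegrable _ _
    refine hi.mono_fun (hgm.comp (measurable_circleMap 0 1)).aestronglyMeasurable
      (Eventually.of_forall fun t => ?_)
    simp only [hg, Real.norm_eq_abs, abs_signedRpow]
    exact le_abs_self _
  have hS : (1 - ‖z‖ ^ 2) ^ (1 - (b + 2) * Q) * circlePowerIntegral b Q ((starRingEnd ℂ) a) z =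
      ∫ t, |k (circleMap 0 1 t)| ^ Q ∂arc := by
    rw [← integral_abs_re_kernel_rpow hz hQ b a, integral_arc]
  rw [hS]
  have hS0 : 0 ≤ ∫ t, |k (circleMap 0 1 t)| ^ Q ∂arc := integral_nonneg fun _ => by positivity
  set f := herglotz 1 fun ζ => (g ζ : ℂ) with hf
  have hfan : AnalyticOnNhd ℂ f (ball 0 1) :=
    analyticOnNhd_circleAverage_herglotzRieszKernel_smul (circleIntegrable_ofReal hgi)
  have hnorm : hpENorm p (fun z => (f z).re) ≤
      ENNReal.ofReal ((∫ t, |k (circleMap 0 1 t)| ^ Q ∂arc) ^ (p⁻¹).toReal) := by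
    by_cases hp' : p = ∞
    · subst hp'
      rw [ENNReal.inv_top, ENNReal.toReal_zero, Real.rpow_zero, ENNReal.ofReal_one]
      rw [ENNReal.inv_top, ENNReal.toReal_zero, zero_add, ENNReal.toReal_inv, inv_eq_one] at hs
      -- When `p = ∞`, `Q = 1` and the data are `±1`, also at zeros of `k`, because `0 ^ 0 = 1`.
      refine hpENorm_top_re_herglotz_le hgi fun t => ?_
      simp only [hg]
      rw [abs_signedRpow, hQd, hs, sub_self, Real.rpow_zero]
    · refine (hpENorm_re_herglotz_le hp hp' hgm hgi).trans (le_of_eq ?_)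
      refine eLpNorm_signedRpow hp hp' ?_ hkQ
      have hP : 1 ≤ p.toReal := by simpa using ENNReal.toReal_mono hp' hp
      rw [ENNReal.toReal_inv, ENNReal.toReal_inv, ← hQd] at hs
      field_simp at hs
      linarith
  refine ⟨f, hfan, ⟨harmonicOnNhd_re hfan, hnorm.trans_lt ENNReal.ofReal_lt_top⟩,
    ENNReal.toReal_le_of_le_ofReal (by positivity) hnorm, ?_⟩
  have h1 := re_iteratedDeriv_herglotz hgi b hz a
  have h2 : ∀ t, (a * (circleMap 0 1 t / (circleMap 0 1 t - z) ^ (b + 2))).re *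
      g (circleMap 0 1 t) = |k (circleMap 0 1 t)| ^ Q := fun t => mul_signedRpow hQ _
  simp only [h2] at h1
  rw [← h1]
  refine (Complex.re_le_norm _).trans (le_of_eq ?_)
  rw [norm_mul, ha, one_mul]

end Extremal

/-! ### Sharpness of the constant, and best approximation. -/

section Sharpness

variable {p q : ℝ≥0∞}

/-- The derivatives of the Herglotz kernel with pole at `1`. -/
theorem iteratedDeriv_one_add_div_one_sub (b : ℕ) {z : ℂ} (hz : ‖z‖ < 1) :
    iteratedDeriv (b + 1) (fun z : ℂ => (1 + z) / (1 - z)) z =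
      2 * (b + 1).factorial / (1 - z) ^ (b + 2) := by
  have hne : ∀ x : ℂ, ‖x‖ < 1 → 1 - x ≠ 0 := by
    intro x hx h
    rw [← sub_eq_zero.1 h, norm_one] at hx
    exact lt_irrefl _ hx
  induction b generalizing z with
  | zero =>
    rw [zero_add, iteratedDeriv_one]
    have h := ((hasDerivAt_id' z).const_add 1).fun_div ((hasDerivAt_id' z).const_sub 1) (hne z hz)
    rw [h.deriv, Nat.factorial_one]
    push_cast
    congr 1
    ring
  | succ b ih =>
    rw [iteratedDeriv_succ]
    have he : iteratedDeriv (b + 1) (fun z : ℂ => (1 + z) / (1 - z)) =ᶠ[𝓝 z] fun x =>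
        2 * (b + 1).factorial * ((1 - x) ^ (b + 2))⁻¹ := by
      filter_upwards [isOpen_ball.mem_nhds (mem_ball_zero_iff.2 hz)] with x hx
      rw [ih (mem_ball_zero_iff.1 hx), div_eq_mul_inv]
    have h := ((((hasDerivAt_id' z).const_sub 1).fun_pow (b + 2)).fun_inv
      (pow_ne_zero _ (hne z hz))).const_mul (2 * ((b + 1).factorial : ℂ))
    rw [he.deriv_eq, h.deriv, Nat.factorial_succ (b + 1)]
    have := hne z hz
    rw [show b + 2 - 1 = b + 1 by omega]
    push_cast
    field_simp
    ring

/-- The extremal for `p = 1`: its real part is the Poisson integral of a point mass at `1`, with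
integral `2π` over every circle about `0`. -/
theorem memHp_one_herglotz_kernel :
    AnalyticOnNhd ℂ (fun z : ℂ => (1 + z) / (1 - z)) (ball 0 1) ∧
    MemHp 1 (fun z : ℂ => ((1 + z) / (1 - z)).re) ∧
    hpNorm 1 (fun z : ℂ => ((1 + z) / (1 - z)).re) ≤ 2 * Real.pi := by
  have han : AnalyticOnNhd ℂ (fun z : ℂ => (1 + z) / (1 - z)) (ball 0 1) := by
    intro z hz
    refine (analyticAt_const.add analyticAt_id).div (analyticAt_const.sub analyticAt_id) ?_
    intro h
    have h1 : z = 1 := (sub_eq_zero.1 h).symm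
    rw [h1, mem_ball_zero_iff, norm_one] at hz
    exact lt_irrefl _ hz
  have hre : ∀ z : ℂ, ((1 + z) / (1 - z)).re = poissonKernel 0 z (circleMap 0 1 0) := by
    intro z
    rw [poissonKernel_eq_re_herglotzRieszKernel, Function.comp_apply, herglotzRieszKernel_def]
    simp [circleMap]
  have hle : hpENorm 1 (fun z : ℂ => ((1 + z) / (1 - z)).re) ≤ ENNReal.ofReal (2 * Real.pi) := by
    refine hpENorm_le_of_eLpNorm_le le_rfl ENNReal.one_ne_top fun r hr => ?_
    have hz := norm_circleMap_zero_lt_one hr 0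
    have hi : Integrable (fun t => poissonKernel 0 (circleMap 0 r 0) (circleMap 0 1 t)) arc := by
      refine Integrable.of_integral_ne_zero ?_
      rw [integral_poissonKernel hz]
      positivity
    rw [eLpNorm_one_eq_lintegral_enorm, ← integral_poissonKernel hz,
      ofReal_integral_eq_lintegral_ofReal hi
        (Eventually.of_forall fun t => poissonKernel_circleMap_nonneg hz t)]
    refine le_of_eq (lintegral_congr fun t => ?_)
    rw [hre, poissonKernel_circleMap_symm, Real.enorm_of_nonneg]
    exact poissonKernel_circleMap_nonneg hz t
  exact ⟨han, ⟨harmonicOnNhd_re han, hle.trans_lt ENNReal.ofReal_lt_top⟩,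
    ENNReal.toReal_le_of_le_ofReal (by positivity) hle⟩

/-- A constant for which the derivative estimate holds is nonnegative. -/
theorem nonneg_of_derivative_bound (hp : 1 ≤ p) (b : ℕ) {K : ℝ}
    (h : ∀ f : ℂ → ℂ, AnalyticOnNhd ℂ f (ball 0 1) → MemHp p (fun z => (f z).re) →
      ∀ z ∈ ball (0 : ℂ) 1, ‖iteratedDeriv (b + 1) f z‖ ≤
        K * (1 - ‖z‖ ^ 2) ^ (-(p⁻¹).toReal - ((b + 1 : ℕ) : ℝ)) * hpNorm p (fun w => (f w).re)) :
    0 ≤ K := by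
  -- The function `z ^ (b + 1)` has derivative `(b + 1)! > 0` at `0`, which is incompatible with `K
  -- < 0`.
  have han := analyticOnNhd_polynomial_eval (Polynomial.X ^ (b + 1)) (ball 0 1)
  obtain ⟨B, hB⟩ := exists_polynomial_bound (Polynomial.X ^ (b + 1))
  have h1 := h _ han ⟨harmonicOnNhd_re han, hpENorm_lt_top_of_bounded hp hB⟩ 0 (by simp)
  simp only [Polynomial.eval_pow, Polynomial.eval_X] at h1
  rw [iteratedDeriv_pow, Nat.descFactorial_self] at h1
  simp only [norm_zero, tsub_self, pow_zero, mul_one, Complex.norm_natCast] at h1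
  norm_num at h1
  by_contra hK
  have h2 : (0 : ℝ) < (b + 1).factorial := by positivity
  have h3 : 0 ≤ hpNorm p fun w => (w ^ (b + 1)).re := ENNReal.toReal_nonneg
  nlinarith [not_le.1 hK]

/-- Extremal functions are tested at `z = r` and `r → 1`. For `q = ∞` this gives `(1 + r)^(b+2) →
2^(b+2)`; otherwise the kernel integral with the maximizing phase tends to its value at `1`. -/
theorem sharpConst_le (hp : 1 ≤ p) (hpq : p⁻¹ + q⁻¹ = 1) (b : ℕ) {K : ℝ}
    (h : ∀ f : ℂ → ℂ, AnalyticOnNhd ℂ f (ball 0 1) → MemHp p (fun z => (f z).re) →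
      ∀ z ∈ ball (0 : ℂ) 1, ‖iteratedDeriv (b + 1) f z‖ ≤
        K * (1 - ‖z‖ ^ 2) ^ (-(p⁻¹).toReal - ((b + 1 : ℕ) : ℝ)) * hpNorm p (fun w => (f w).re)) :
    sharpConst (b + 1) q ≤ K := by
  have hK := nonneg_of_derivative_bound hp b h
  have hq := one_le_conjugate hpq
  have hs := toReal_inv_add_toReal_inv hpq
  have hfac : (0 : ℝ) < (b + 1).factorial := by positivity
  have hpi := Real.pi_pos
  have hnr : ∀ r : ℝ, r ∈ Ioo (0 : ℝ) 1 → ‖(r : ℂ)‖ = r := fun r hr => by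
    rw [Complex.norm_real, Real.norm_of_nonneg hr.1.le]
  by_cases hq' : q = ∞
  · subst hq'
    have hp1 : p = 1 := by
      rw [ENNReal.inv_top, add_zero] at hpq
      rw [← inv_inv p, hpq, inv_one]
    subst hp1
    obtain ⟨han, hmem, hnorm⟩ := memHp_one_herglotz_kernel
    rw [sharpConst_top]
    have hr : ∀ r ∈ Ioo (0 : ℝ) 1,
        ((b + 1).factorial : ℝ) / Real.pi * (1 + r) ^ (b + 2) ≤ K := by
      intro r hr
      have h1 := h _ han hmem r (by rw [mem_ball_zero_iff, hnr r hr]; exact hr.2)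
      have hx : 0 < 1 - r := by linarith [hr.2]
      have hy : 0 < 1 + r := by linarith [hr.1]
      have e : 1 - r ^ 2 = (1 - r) * (1 + r) := by ring
      have e1 : (-((1 : ℝ≥0∞)⁻¹).toReal - ((b + 1 : ℕ) : ℝ)) = -((b + 2 : ℕ) : ℝ) := by
        rw [inv_one, ENNReal.toReal_one]; push_cast; ring
      have e2 : ‖(1 - (r : ℂ))‖ = 1 - r := by
        rw [← ofReal_one, ← ofReal_sub, Complex.norm_real, Real.norm_of_nonneg hx.le]
      rw [iteratedDeriv_one_add_div_one_sub b (by rw [hnr r hr]; exact hr.2), hnr r hr, e, e1,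
        Real.rpow_neg (by positivity), Real.rpow_natCast, norm_div, norm_mul, norm_pow, e2,
        Complex.norm_natCast, Complex.norm_ofNat, mul_pow] at h1
      have h2 := h1.trans (mul_le_mul_of_nonneg_left hnorm (by positivity))
      rw [div_le_iff₀ (by positivity)] at h2
      have h3 : K * ((1 - r) ^ (b + 2) * (1 + r) ^ (b + 2))⁻¹ * (2 * Real.pi) * (1 - r) ^ (b + 2) =
          K * (2 * Real.pi) / (1 + r) ^ (b + 2) := by
        field_simp
      rw [h3, le_div_iff₀ (by positivity)] at h2
      rw [div_mul_eq_mul_div, div_le_iff₀ hpi]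
      nlinarith
    have hc : ContinuousAt
        (fun r : ℝ => ((b + 1).factorial : ℝ) / Real.pi * (1 + r) ^ (b + 2)) 1 := by fun_prop
    have ht := hc.tendsto.mono_left (nhdsWithin_le_nhds (s := Iio 1))
    rw [show (1 : ℝ) + 1 = 2 by norm_num] at ht
    refine le_of_tendsto ht ?_
    filter_upwards [Ioo_mem_nhdsLT zero_lt_one] with r hr'
    exact hr r hr'
  · have hQ : 1 ≤ q.toReal := by simpa using ENNReal.toReal_mono hq' hq
    obtain ⟨β, hβ, hmax⟩ := exists_isMaxOn_FRoot hq b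
    have hsup : sSup (FRoot (b + 1) q '' Icc 0 (Real.pi / 2)) = FRoot (b + 1) q β :=
      IsGreatest.csSup_eq ⟨mem_image_of_mem _ hβ, by rintro _ ⟨x, hx, rfl⟩; exact hmax hx⟩
    rw [sharpConst, mul_assoc, hsup, ← FRoot_eq_circlePowerIntegral hq hq']
    set c : ℂ := exp (β * I) with hcdef
    have hcn : ‖c‖ = 1 := Complex.norm_exp_ofReal_mul_I β
    have hr : ∀ r ∈ Ioo (0 : ℝ) 1, ((b + 1).factorial : ℝ) / Real.pi *
        circlePowerIntegral b q.toReal c r ^ (1 / q.toReal) ≤ K := by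
      intro r hr
      have hz : ‖(r : ℂ)‖ < 1 := by rw [hnr r hr]; exact hr.2
      obtain ⟨f, han, hmem, hnorm, hder⟩ := exists_extremal hp hpq hq' b hz
        (a := (starRingEnd ℂ) c) (by simpa)
      rw [Complex.conj_conj] at hnorm hder
      have hρ : 0 < 1 - ‖(r : ℂ)‖ ^ 2 := by nlinarith [norm_nonneg (r : ℂ)]
      have h1 := h f han hmem r (mem_ball_zero_iff.2 hz)
      generalize 1 - ‖(r : ℂ)‖ ^ 2 = ρ at hρ hnorm hder h1
      have hJ := circlePowerIntegral_nonneg (b := b) (Q := q.toReal) c r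
      generalize circlePowerIntegral b q.toReal c r = J at hJ hnorm hder
      -- If the kernel integral vanishes, the extremal function carries no information, and only `0
      -- ≤ K` is needed.
      rcases hJ.eq_or_lt with hJ0 | hJ0
      · rw [← hJ0, Real.zero_rpow (by positivity), mul_zero]
        exact hK
      have hS : 0 < ρ ^ (1 - (b + 2) * q.toReal) * J := by positivity
      have h2 := (hder.trans h1).trans (mul_le_mul_of_nonneg_left hnorm (by positivity))
      have e1 : (1 - (b + 2) * q.toReal) * (1 / q.toReal) =
          -(p⁻¹).toReal - ((b + 1 : ℕ) : ℝ) := by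
        rw [ENNReal.toReal_inv q] at hs
        have : (p⁻¹).toReal = 1 - (q.toReal)⁻¹ := by linarith
        rw [this]
        push_cast
        field_simp
        ring
      -- This is `X = X^(1/q) X^(1/p)`; the factor `X^(1/p)`, which bounds the norm of the extremal
      -- function, cancels.
      have e2 : ρ ^ (1 - (b + 2) * q.toReal) * J =
          (ρ ^ (-(p⁻¹).toReal - ((b + 1 : ℕ) : ℝ)) * J ^ (1 / q.toReal)) *
            (ρ ^ (1 - (b + 2) * q.toReal) * J) ^ (p⁻¹).toReal := by
        rw [← e1, Real.rpow_mul hρ.le, ← Real.mul_rpow (by positivity) hJ, ← Real.rpow_add hS,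
          one_div, ← ENNReal.toReal_inv,
          add_comm (q⁻¹).toReal, hs, Real.rpow_one]
      generalize ρ ^ (1 - (b + 2) * q.toReal) * J = X at hS h2 e2
      have hA : 0 < ρ ^ (-(p⁻¹).toReal - ((b + 1 : ℕ) : ℝ)) * X ^ (p⁻¹).toReal := by positivity
      rw [← mul_le_mul_iff_of_pos_right hA]
      calc _ = ((b + 1).factorial : ℝ) / Real.pi *
            (ρ ^ (-(p⁻¹).toReal - ((b + 1 : ℕ) : ℝ)) * J ^ (1 / q.toReal) * X ^ (p⁻¹).toReal) := by
            ring
        _ = ((b + 1).factorial : ℝ) / Real.pi * X := by rw [← e2]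
        _ ≤ _ := h2
        _ = _ := by ring
    have hc : Continuous (fun r : ℝ => ((b + 1).factorial : ℝ) / Real.pi *
        circlePowerIntegral b q.toReal c r ^ (1 / q.toReal)) := by
      refine continuous_const.mul (Continuous.rpow_const ?_ fun _ => Or.inr (by positivity))
      exact (continuous_circlePowerIntegral b hQ).comp
        (by fun_prop : Continuous fun r : ℝ => (c, (r : ℂ)))
    have ht := (hc.tendsto 1).mono_left (nhdsWithin_le_nhds (s := Iio 1))
    rw [ofReal_one] at ht
    refine le_of_tendsto ht ?_
    filter_upwards [Ioo_mem_nhdsLT zero_lt_one] with r hr'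
    exact hr r hr'

/-- An estimate by all the norms `‖u - Re P‖` is an estimate by the best approximation. -/
theorem le_mul_bestApprox (m : ℕ) {u : ℂ → ℝ} (hu : hpENorm p u < ∞) {A D : ℝ}
    (hA : 0 ≤ A) (h : ∀ P : Polynomial ℂ, P.natDegree ≤ m →
      hpENorm p (fun z => u z - (P.eval z).re) < ∞ ∧
        D ≤ A * (hpENorm p (fun z => u z - (P.eval z).re)).toReal) :
    D ≤ A * bestApprox m p u := by
  -- Finiteness, witnessed by `P = 0`, ensures that `toReal` does not collapse an infinite infimum
  -- to `0`.
  have htop : (⨅ P : {P : Polynomial ℂ // P.natDegree ≤ m},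
      hpENorm p (fun z => u z - ((P : Polynomial ℂ).eval z).re)) ≠ ∞ := by
    refine ne_top_of_le_ne_top hu.ne ((iInf_le _ ⟨0, by simp⟩).trans (le_of_eq ?_))
    simp
  rcases hA.eq_or_lt with hA0 | hA0
  · have := (h 0 (by simp)).2
    rw [← hA0, zero_mul] at this ⊢
    exact this
  · rw [← div_le_iff₀' hA0, bestApprox]
    refine (ENNReal.ofReal_le_iff_le_toReal htop).1 (le_iInf fun P => ?_)
    obtain ⟨h1, h2⟩ := h P.1 P.2
    rw [ENNReal.ofReal_le_iff_le_toReal h1.ne, div_le_iff₀' hA0]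
    exact h2

end Sharpness

end HardyReal

/-! ### The main theorem. -/

theorem theorem1 (p q : ENNReal) (hp : 1 ≤ p) (hpq : p⁻¹ + q⁻¹ = 1) (n : ℕ) (hn : 1 ≤ n) :
    -- the maximum in the constant is attained
    (∃ β₀ ∈ Set.Icc (0 : ℝ) (Real.pi / 2),
      IsMaxOn (HardyReal.FRoot n q) (Set.Icc 0 (Real.pi / 2)) β₀) ∧
    -- the inequality, for every `f` and every polynomial of degree at most `n - 1`
    (∀ f : ℂ → ℂ, AnalyticOnNhd ℂ f (Metric.ball 0 1) →
      HardyReal.MemHp p (fun z => (f z).re) →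
      ∀ P : Polynomial ℂ, P.natDegree ≤ n - 1 →
        HardyReal.MemHp p (fun z => (f z - P.eval z).re) ∧
        ∀ z ∈ Metric.ball (0 : ℂ) 1,
          ‖iteratedDeriv n f z‖ ≤
            HardyReal.sharpConst n q * (1 - ‖z‖ ^ 2) ^ (-(p⁻¹).toReal - (n : ℝ)) *
              HardyReal.hpNorm p (fun w => (f w - P.eval w).re)) ∧
    -- the constant is sharp, whatever the polynomial is
    (∀ P : Polynomial ℂ, P.natDegree ≤ n - 1 → ∀ K : ℝ,
      (∀ f : ℂ → ℂ, AnalyticOnNhd ℂ f (Metric.ball 0 1) →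
        HardyReal.MemHp p (fun z => (f z).re) →
        ∀ z ∈ Metric.ball (0 : ℂ) 1,
          ‖iteratedDeriv n f z‖ ≤
            K * (1 - ‖z‖ ^ 2) ^ (-(p⁻¹).toReal - (n : ℝ)) *
              HardyReal.hpNorm p (fun w => (f w - P.eval w).re)) →
      HardyReal.sharpConst n q ≤ K) ∧
    -- the bound by the best approximation
    (∀ f : ℂ → ℂ, AnalyticOnNhd ℂ f (Metric.ball 0 1) →
      HardyReal.MemHp p (fun z => (f z).re) →
      ∀ z ∈ Metric.ball (0 : ℂ) 1,
        ‖iteratedDeriv n f z‖ ≤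
          HardyReal.sharpConst n q * (1 - ‖z‖ ^ 2) ^ (-(p⁻¹).toReal - (n : ℝ)) *
            HardyReal.bestApprox (n - 1) p (fun w => (f w).re)) := by
  obtain ⟨b, rfl⟩ : ∃ b, n = b + 1 := ⟨n - 1, by omega⟩
  simp only [Nat.add_sub_cancel]
  have hq := HardyReal.one_le_conjugate hpq
  have hbound : ∀ f : ℂ → ℂ, AnalyticOnNhd ℂ f (Metric.ball 0 1) →
      HardyReal.MemHp p (fun z => (f z).re) →
      ∀ P : Polynomial ℂ, P.natDegree ≤ b →
        HardyReal.MemHp p (fun z => (f z - P.eval z).re) ∧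
        ∀ z ∈ Metric.ball (0 : ℂ) 1,
          ‖iteratedDeriv (b + 1) f z‖ ≤
            HardyReal.sharpConst (b + 1) q *
              (1 - ‖z‖ ^ 2) ^ (-(p⁻¹).toReal - ((b + 1 : ℕ) : ℝ)) *
              HardyReal.hpNorm p (fun w => (f w - P.eval w).re) := by
    intro f hf hu P hP
    have hmem := HardyReal.MemHp.re_sub_polynomial hp hf hu P
    refine ⟨hmem, fun z hz => ?_⟩
    rw [← HardyReal.iteratedDeriv_sub_polynomial (hf z hz) hP]
    exact HardyReal.norm_iteratedDeriv_le hp hpq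
      (hf.sub (HardyReal.analyticOnNhd_polynomial_eval P _)) hmem b hz
  refine ⟨HardyReal.exists_isMaxOn_FRoot hq b, hbound, ?_, ?_⟩
  · intro P hP K hK
    -- Applying the assumed bound to `f + P` removes the polynomial from the norm without changing
    -- the derivative, so sharpness reduces to `P = 0`.
    refine HardyReal.sharpConst_le hp hpq b fun f hf hu z hz => ?_
    have hf' : AnalyticOnNhd ℂ (fun w => f w + P.eval w) (Metric.ball 0 1) :=
      hf.add (HardyReal.analyticOnNhd_polynomial_eval P _)
    have hu' : HardyReal.MemHp p (fun w => (f w + P.eval w).re) := by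
      simpa using HardyReal.MemHp.re_sub_polynomial hp hf hu (-P)
    have h := hK _ hf' hu' z hz
    rw [← HardyReal.iteratedDeriv_sub_polynomial (hf' z hz) hP] at h
    simpa only [add_sub_cancel_right] using h
  · intro f hf hu z hz
    have hr : 0 ≤ 1 - ‖z‖ ^ 2 := by
      rw [mem_ball_zero_iff] at hz
      nlinarith [norm_nonneg z]
    refine HardyReal.le_mul_bestApprox b hu.2 (mul_nonneg (HardyReal.sharpConst_nonneg hq b)
      (Real.rpow_nonneg hr _)) fun P hP => ?_
    obtain ⟨h1, h2⟩ := hbound f hf hu P hP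
    simp only [← Complex.sub_re]
    exact ⟨h1.2, h2 z hz⟩
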